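/- Let $(R,\mathfrak m,\mathbb K)$ be a regular local ring with a fixed regular system of parameters $x=(x_1,\dots,x_n)$ ($n=\dim R$), and let $\widehat R$ be its $\mathfrak m$-adic completion, a regular local ring with regular system of parameters the images of $x_1,\dots,x_n$ and with residue field canonically identified with $\mathbb K$. An expansion of an element $f$ of $R$ (or of $\widehat R$) is a finite sum $f=\sum_{\alpha\in\mathbb Z_{\ge 0}^n}a_\alpha x^\alpha$ in which every $a_\alpha$ is a unit or $0$. The Newton polyhedron $\Delta(f)$ is the convex hull of $\{\alpha: a_\alpha\ne 0\}+\mathbb R_{\ge 0}^n$. A face of $\Delta=\Delta(f)$ is a set $\Delta^\xi=\{p\in\Delta:\langle\xi,p\rangle=\min_{q\in\Delta}\langle\xi,q\rangle\}$ with $\xi\in\mathbb R_{\ge 0}^n$, and its dimension is that of its affine hull. A loose edge is a compact face of dimension $1$ that is not contained in any compact face of dimension $\ge 2$. For a compact face $A$ of $\Delta(f)$, the symbolic restriction of $f$ to $A$ is $f|_A=\sum_{\alpha\in A}\overline{a_\alpha}\,X^\alpha\in\mathbb K[X_1,\dots,X_n]$, where $\overline{a_\alpha}$ is the residue class of $a_\alpha$.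 (Expansions are not unique, but $\Delta(f)$ and $f|_A$ do not depend on the one chosen.) Theorem. Let $f\in R$ be nonzero and suppose that $\Delta(f)$ has a loose edge $E$. Suppose that $f|_E=GH$ with relatively prime polynomials $G,H\in\mathbb K[X_1,\dots,X_n]$ (that is, every common divisor of $G$ and $H$ is a constant), where $G$ is not divisible by any variable $X_i$. Then there exist $g,h\in\widehat R$ with $f=gh$ in $\widehat R$, a compact face $E_1$ of $\Delta(g)$ and a compact face $E_2$ of $\Delta(h)$ such that $g|_{E_1}=G$, $h|_{E_2}=H$ and $E=E_1+E_2$ (Minkowski sum). -/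

import Mathlib

open scoped Pointwise

namespace NewtonEdge

noncomputable section

/-- `x` is a regular system of parameters of the (regular) local ring `R`: it generates the
maximal ideal and its length is the Krull dimension of `R`. -/
def IsRegularSystemOfParameters {R : Type*} [CommRing R] [IsLocalRing R] {n : ℕ}
    (x : Fin n → R) : Prop :=
  Ideal.span (Set.range x) = IsLocalRing.maximalIdeal R ∧
    ringKrullDim R = (n : WithBot ℕ∞)

/-- `a` is a finite expansion `f = ∑ a_α x^α` of `f` whose coefficients are units or zero.
(The family of coefficients `a_α` is recorded as a polynomial.) -/
def IsExpansion {R : Type*} [CommRing R] {n : ℕ} (x : Fin n → R) (f : R)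
    (a : MvPolynomial (Fin n) R) : Prop :=
  (∀ α : Fin n →₀ ℕ, a.coeff α = 0 ∨ IsUnit (a.coeff α)) ∧ MvPolynomial.eval x a = f

/-- An exponent vector, seen as a point of `ℝⁿ`. -/
def toPoint {n : ℕ} (α : Fin n →₀ ℕ) : Fin n → ℝ := fun i => (α i : ℝ)

/-- The Newton polyhedron of an expansion `a`: the convex hull of
`{α : a_α ≠ 0} + ℝ_{≥0}ⁿ`. -/
def newtonPolyhedron {R : Type*} [CommRing R] {n : ℕ} (a : MvPolynomial (Fin n) R) :
    Set (Fin n → ℝ) :=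
  convexHull ℝ (toPoint '' {α | a.coeff α ≠ 0} + {v : Fin n → ℝ | 0 ≤ v})

/-- The points of `Δ` at which the linear form `⟨ξ, ·⟩` attains its minimum on `Δ`. -/
def faceOf {n : ℕ} (Δ : Set (Fin n → ℝ)) (ξ : Fin n → ℝ) : Set (Fin n → ℝ) :=
  {p | p ∈ Δ ∧ ∀ q ∈ Δ, ξ ⬝ᵥ p ≤ ξ ⬝ᵥ q}

/-- A compact face of `Δ`: a compact set of the form `Δ^ξ` with `ξ ∈ ℝ_{≥0}ⁿ`. -/
def IsCompactFace {n : ℕ} (Δ A : Set (Fin n → ℝ)) : Prop :=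
  (∃ ξ : Fin n → ℝ, 0 ≤ ξ ∧ A = faceOf Δ ξ) ∧ IsCompact A

/-- The dimension of a face: the dimension of its affine hull. -/
def faceDim {n : ℕ} (A : Set (Fin n → ℝ)) : ℕ := Module.finrank ℝ (vectorSpan ℝ A)

/-- A loose edge: a compact face of dimension one which is not contained in any compact face
of dimension at least two. -/
def IsLooseEdge {n : ℕ} (Δ E : Set (Fin n → ℝ)) : Prop :=
  IsCompactFace Δ E ∧ faceDim E = 1 ∧
    ∀ F : Set (Fin n → ℝ), IsCompactFace Δ F → E ⊆ F → ¬ 2 ≤ faceDim F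

open Classical in
/-- The symbolic restriction to `A` of an expansion `a`: the polynomial
`∑_{α ∈ A} ā_α X^α` over the residue field. -/
def symbolicRestriction {R : Type*} [CommRing R] [IsLocalRing R] {n : ℕ}
    (a : MvPolynomial (Fin n) R) (A : Set (Fin n → ℝ)) :
    MvPolynomial (Fin n) (IsLocalRing.ResidueField R) :=
  ∑ α ∈ a.support.filter (fun α => toPoint α ∈ A),
    MvPolynomial.monomial α (IsLocalRing.residue R (a.coeff α))

/-- The `𝔪`-adic completion of a local ring `(R, 𝔪)`. -/
abbrev Completion (R : Type*) [CommRing R] [IsLocalRing R] : Type _ :=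
  AdicCompletion (IsLocalRing.maximalIdeal R) R

/-- Transport of polynomials along the canonical map (an isomorphism) from the residue field
of `R` to the residue field of its completion. -/
def toCompletion {R : Type*} [CommRing R] [IsLocalRing R] [IsNoetherianRing R] {n : ℕ}
    (G : MvPolynomial (Fin n) (IsLocalRing.ResidueField R)) :
    MvPolynomial (Fin n) (IsLocalRing.ResidueField (Completion R)) :=
  MvPolynomial.map (IsLocalRing.ResidueField.map (algebraMap R (Completion R))) G

/-- `A` is a compact face of the Newton polyhedron of the element `g`, and the symbolic
restriction of `g` to `A` is `P`. Expansions of `g` with respect to `x` are not unique, so this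
asks that one exists and that the two assertions hold for every one of them. -/
def HasSymbolicRestriction {R : Type*} [CommRing R] [IsLocalRing R] {n : ℕ} (x : Fin n → R)
    (g : R) (A : Set (Fin n → ℝ)) (P : MvPolynomial (Fin n) (IsLocalRing.ResidueField R)) :
    Prop :=
  (∃ b, IsExpansion x g b) ∧
    ∀ b, IsExpansion x g b →
      IsCompactFace (newtonPolyhedron b) A ∧ symbolicRestriction b A = P

end

end NewtonEdge

/-!
# Factorization along a loose edge of the Newton polyhedron

A loose edge `E` of `Δ(f)` is minimal not only for one positive linear form `ξ`, but for every
positive form that is constant on `E`: moving from `ξ` towards a form that violates this, the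
first new exponent that becomes minimal would span, with `E`, a compact face of dimension at least
two (`dotProduct_le_of_isLooseEdge`). By duality, all exponents of `f` lie in the cone
`E + ℝ c + ℝ_{≥0}ⁿ`, where `c` is the primitive integral direction of `E`
(`IsLooseEdge.exists_direction`).

The factors `G` and `H` of `f|_E` are supported on lines parallel to `c`, and since no variable
divides `G`, its first exponent is as small as possible: `d * max 0 (-c i)`, with `d` the lattice
length of `G`. The heart of the proof is that a monomial with exponent in the cone is then a
combination `G A + H B`, with `A` and `B` supported on the lines that homogeneity forces
(`exists_eq_mul_add_mul`). It follows from coprimality by a comparison of dimensions, which are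
numbers of lattice points on lines. This solves the linearized problem of Hensel's lemma. Filtering
`R̂` by the ideals generated by the monomials of large `ξ`-weight in the cone, one improves lifts of
`G` and `H` step by step, and completeness yields the factors `g` and `h` (`exists_factors`). They
differ from the lifts by terms of larger weight, so that their initial faces are the Newton
segments of `G` and `H`, whose Minkowski sum is `E` (`convexHull_support_mul`).

To speak of Newton polyhedra in `R̂` one needs that every element has a finite expansion, which
follows from completeness and Dickson's lemma (`exists_isExpansion`), and that compact faces and
symbolic restrictions do not depend on it
(`MonomiallyIndependent.hasSymbolicRestriction`). The latter rests on the fact that a monomial in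
a regular system of parameters lies in a monomial ideal only for the obvious reason
(`MonomiallyIndependent`). In `R` this holds because such a system, and with it the system of any
powers of its members, is a regular sequence; it passes to `R̂` since it can be tested modulo a
power of the maximal ideal.
-/

namespace NewtonEdge

/-! ### Regular local rings and monomials in a regular system of parameters -/

section Regular

open IsLocalRing

/-- An element of `𝔪` outside `𝔪²` can be exchanged for one of the generators of `𝔪`. -/
lemma exists_mem_span_insert_erase {R : Type*} [CommRing R] [IsLocalRing R] [DecidableEq R]
    {s : Finset R} (hs : Ideal.span (s : Set R) = maximalIdeal R) {z : R}
    (hz : z ∈ maximalIdeal R) (hz2 : z ∉ maximalIdeal R ^ 2) :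
    ∃ y ∈ s, y ∈ Ideal.span (insert z (s.erase y : Set R)) := by
  rw [← hs] at hz
  obtain ⟨r, -, hr⟩ := Submodule.mem_span_finset.1 hz
  have hex : ∃ y ∈ s, IsUnit (r y) := by
    by_contra! hcon
    refine hz2 ?_
    rw [← hr, pow_two]
    refine Ideal.sum_mem _ fun y hy => Ideal.mul_mem_mul ?_ ?_
    · exact (mem_maximalIdeal _).2 (hcon y hy)
    · rw [← hs]; exact Ideal.subset_span hy
  obtain ⟨y, hy, u, hu⟩ := hex
  refine ⟨y, hy, ?_⟩
  have hsum : y = (↑u⁻¹ : R) * (z - ∑ w ∈ s.erase y, r w * w) := by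
    rw [← hr, ← Finset.add_sum_erase s _ hy]
    simp [← hu]
  have key : (↑u⁻¹ : R) * (z - ∑ w ∈ s.erase y, r w * w) ∈
      Ideal.span (insert z (s.erase y : Set R)) := by
    refine Ideal.mul_mem_left _ _ (sub_mem (Ideal.subset_span (by simp)) ?_)
    exact Ideal.sum_mem _ fun w hw => Ideal.mul_mem_left _ _
      (Ideal.subset_span (Set.mem_insert_of_mem _ hw))
  rwa [← hsum] at key

lemma maximalIdeal_quotient_eq_map {R : Type*} [CommRing R] [IsLocalRing R] (I : Ideal R)
    [IsLocalRing (R ⧸ I)] :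
    maximalIdeal (R ⧸ I) = (maximalIdeal R).map (Ideal.Quotient.mk I) :=
  (map_maximalIdeal_of_surjective _ Ideal.Quotient.mk_surjective).symm

/-- A regular local ring is a domain. Induction on the dimension: an element `z ∈ 𝔪` outside
`𝔪²` and outside the minimal primes has a regular quotient `R ⧸ (z)`, so `(z)` is prime; a
minimal prime `P` below `(z)` satisfies `P = z P` and vanishes by Nakayama's lemma. -/
theorem isDomain_of_span_card_le {k : ℕ} {R : Type*} [CommRing R] [IsLocalRing R]
    [IsNoetherianRing R] (s : Finset R) (hs : Ideal.span (s : Set R) = maximalIdeal R)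
    (hk : s.card ≤ k) (hdim : (k : WithBot ℕ∞) ≤ ringKrullDim R) : IsDomain R := by
  classical
  induction k generalizing R with
  | zero =>
    have h0 : s = ∅ := by simpa using hk
    rw [h0] at hs
    have hf : IsField R := by
      rw [IsLocalRing.isField_iff_maximalIdeal_eq, ← hs]; simp
    exact hf.isDomain
  | succ k ih =>
    have hpos : (0 : WithBot ℕ∞) < ringKrullDim R := lt_of_lt_of_le (by norm_cast; omega) hdim
    have hnmin : ∀ P ∈ minimalPrimes R, ¬ maximalIdeal R ≤ P := by
      intro P hP hle
      have hPp : P.IsPrime := hP.1.1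
      have hPeq : P = maximalIdeal R := le_antisymm (le_maximalIdeal hPp.ne_top) hle
      have h1 := maximalIdeal_height_eq_ringKrullDim (R := R)
      rw [← hPeq, Ideal.height_eq_zero_iff.2 hP] at h1
      rw [← h1] at hpos
      exact lt_irrefl _ hpos
    have hne : maximalIdeal R ≠ ⊥ := by
      intro h0
      have hf : IsField R := IsLocalRing.isField_iff_maximalIdeal_eq.2 h0
      rw [ringKrullDim_eq_zero_of_isField hf] at hpos
      exact lt_irrefl _ hpos
    have hsq : ¬ maximalIdeal R ≤ maximalIdeal R ^ 2 := by
      intro hle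
      apply hne
      refine Submodule.eq_bot_of_le_smul_of_le_jacobson_bot (maximalIdeal R) _
        (IsNoetherian.noetherian _) ?_ (maximalIdeal_le_jacobson _)
      rwa [smul_eq_mul, ← pow_two]
    obtain ⟨z, hzm, hz⟩ : ∃ z ∈ maximalIdeal R, z ∉ maximalIdeal R ^ 2 ∧
        ∀ P ∈ minimalPrimes R, z ∉ P := by
      by_contra! hcon
      have hfin := minimalPrimes.finite_of_isNoetherianRing R
      have hsub := (Ideal.subset_union_prime (s := insert (maximalIdeal R ^ 2) hfin.toFinset)
        (f := fun I => I) (maximalIdeal R ^ 2) (maximalIdeal R ^ 2)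
        (I := maximalIdeal R) ?_).1 ?_
      · obtain ⟨P, hP, hle⟩ := hsub
        rcases Finset.mem_insert.1 hP with rfl | hP
        · exact hsq hle
        · exact hnmin P (by simpa using hP) hle
      · intro P hP hPne _
        have : P ∈ minimalPrimes R := by simpa [hPne] using hP
        exact this.1.1
      · intro z hz
        by_cases h2 : z ∈ maximalIdeal R ^ 2
        · exact Set.mem_biUnion (x := maximalIdeal R ^ 2) (by simp) h2
        · obtain ⟨P, hP, hzP⟩ := hcon z hz h2
          exact Set.mem_biUnion (x := P) (by simp [hP]) hzP
    obtain ⟨y, hy, hyspan⟩ := exists_mem_span_insert_erase hs hzm hz.1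
    have hspan : maximalIdeal R = Ideal.span (insert z (s.erase y : Set R)) := by
      apply le_antisymm
      · rw [← hs, Ideal.span_le]
        intro w hw
        by_cases hwy : w = y
        · rw [hwy]; exact hyspan
        · exact Ideal.subset_span (Set.mem_insert_of_mem _ (by simpa [hwy] using hw))
      · rw [Ideal.span_le]
        rintro w (rfl | hw)
        · exact hzm
        · rw [← hs]; exact Ideal.subset_span (Finset.mem_of_mem_erase hw)
    let I : Ideal R := Ideal.span {z}
    have hI : I ≤ maximalIdeal R := by rwa [Ideal.span_singleton_le_iff_mem]
    have hItop : I ≠ ⊤ := fun h => (maximalIdeal.isMaximal R).ne_top (top_le_iff.1 (h ▸ hI))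
    have : Nontrivial (R ⧸ I) := Ideal.Quotient.nontrivial_iff.2 hItop
    have : IsLocalRing (R ⧸ I) :=
      IsLocalRing.of_surjective' (Ideal.Quotient.mk I) Ideal.Quotient.mk_surjective
    have hdom : IsDomain (R ⧸ I) := by
      refine ih ((s.erase y).image (Ideal.Quotient.mk I)) ?_ ?_ ?_
      · rw [maximalIdeal_quotient_eq_map, hspan, Ideal.map_span, Set.image_insert_eq,
          Finset.coe_image, (Ideal.Quotient.eq_zero_iff_mem (I := I)).2
            (Ideal.mem_span_singleton_self z), Ideal.span_insert_zero]
      · refine Finset.card_image_le.trans ?_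
        rw [Finset.card_erase_of_mem hy]; omega
      · have h1 := ringKrullDim_le_ringKrullDim_quotient_add_card ({z} : Finset R)
          (by simpa [IsLocalRing.ringJacobson_eq_maximalIdeal] using hzm)
        rw [Finset.coe_singleton] at h1
        have h2 := hdim.trans h1
        simp only [Finset.card_singleton] at h2
        push_cast at h2
        have h3 : (k : WithBot ℕ∞) + 1 ≤ ringKrullDim (R ⧸ I) + 1 := h2
        exact (ENat.WithBot.add_le_add_one_right_iff).1 h3
    have hIp : I.IsPrime := (Ideal.Quotient.isDomain_iff_prime I).1 hdom
    obtain ⟨P, hP, hPI⟩ := Ideal.exists_minimalPrimes_le (bot_le : (⊥ : Ideal R) ≤ I)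
    have hPp : P.IsPrime := hP.1.1
    have hPbot : P = ⊥ := by
      refine Submodule.eq_bot_of_le_smul_of_le_jacobson_bot (maximalIdeal R) _
        (IsNoetherian.noetherian _) ?_ (maximalIdeal_le_jacobson _)
      intro p hp
      obtain ⟨b, rfl⟩ := Ideal.mem_span_singleton'.1 (hPI hp)
      have hb : b ∈ P := (hPp.mem_or_mem hp).resolve_right (hz.2 P hP)
      rw [mul_comm]
      exact Submodule.smul_mem_smul hzm hb
    have : (⊥ : Ideal R).IsPrime := hPbot ▸ hPp
    exact IsDomain.of_bot_isPrime R

lemma IsRegularSystemOfParameters.mem_maximalIdeal {R : Type*} [CommRing R] [IsLocalRing R]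
    {n : ℕ} {x : Fin n → R} (hx : IsRegularSystemOfParameters x) (i : Fin n) :
    x i ∈ maximalIdeal R := by
  rw [← hx.1]; exact Ideal.subset_span ⟨i, rfl⟩

variable {R : Type*} [CommRing R] [IsLocalRing R] [IsNoetherianRing R] {n : ℕ} {x : Fin n → R}

/-- Any part of a regular system of parameters generates a prime ideal. -/
lemma IsRegularSystemOfParameters.isPrime_span (hx : IsRegularSystemOfParameters x)
    (T : Finset (Fin n)) : (Ideal.span (x '' T)).IsPrime := by
  classical
  let I : Ideal R := Ideal.span (x '' T)
  have hI : I ≤ maximalIdeal R := by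
    rw [Ideal.span_le]; rintro _ ⟨i, -, rfl⟩; exact hx.mem_maximalIdeal i
  have hItop : I ≠ ⊤ := fun h => (maximalIdeal.isMaximal R).ne_top (top_le_iff.1 (h ▸ hI))
  have : Nontrivial (R ⧸ I) := Ideal.Quotient.nontrivial_iff.2 hItop
  have : IsLocalRing (R ⧸ I) :=
    IsLocalRing.of_surjective' (Ideal.Quotient.mk I) Ideal.Quotient.mk_surjective
  rw [← Ideal.Quotient.isDomain_iff_prime]
  refine isDomain_of_span_card_le (k := n - T.card)
    ((Finset.univ \ T).image fun i => Ideal.Quotient.mk I (x i)) ?_ ?_ ?_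
  · rw [maximalIdeal_quotient_eq_map, ← hx.1, Ideal.map_span]
    apply le_antisymm
    · refine Ideal.span_mono ?_
      intro w hw
      simp only [Finset.coe_image, Set.mem_image] at hw
      obtain ⟨i, -, rfl⟩ := hw
      exact ⟨x i, ⟨i, rfl⟩, rfl⟩
    · rw [Ideal.span_le]
      rintro _ ⟨_, ⟨i, rfl⟩, rfl⟩
      by_cases hi : i ∈ T
      · have h0 : Ideal.Quotient.mk I (x i) = 0 :=
          Ideal.Quotient.eq_zero_iff_mem.2 (Ideal.subset_span ⟨i, hi, rfl⟩)
        rw [h0]; exact zero_mem _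
      · refine Ideal.subset_span ?_
        simp only [Finset.coe_image, Set.mem_image]
        exact ⟨i, by simpa using hi, rfl⟩
  · refine Finset.card_image_le.trans ?_
    rw [Finset.card_sdiff_of_subset (Finset.subset_univ _), Finset.card_fin]
  · have h1 := ringKrullDim_le_ringKrullDim_quotient_add_card (T.image x) (by
      rw [IsLocalRing.ringJacobson_eq_maximalIdeal]
      simp only [Finset.coe_image]
      rintro _ ⟨i, -, rfl⟩
      exact hx.mem_maximalIdeal i)
    rw [Finset.coe_image, hx.2] at h1
    have hT : T.card ≤ n := by simpa using Finset.card_le_univ T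
    have h2 : (n : WithBot ℕ∞) ≤ ringKrullDim (R ⧸ I) + (T.card : WithBot ℕ∞) :=
      h1.trans (by
        refine add_le_add le_rfl ?_
        exact_mod_cast (Finset.card_image_le : (T.image x).card ≤ T.card))
    have h3 : ((n - T.card : ℕ) : WithBot ℕ∞) + (T.card : WithBot ℕ∞) = n := by
      exact_mod_cast Nat.sub_add_cancel hT
    rw [← h3] at h2
    exact (ENat.WithBot.add_le_add_natCast_right_iff).1 h2

lemma IsRegularSystemOfParameters.notMem_span (hx : IsRegularSystemOfParameters x)
    {T : Finset (Fin n)} {i : Fin n} (hi : i ∉ T) : x i ∉ Ideal.span (x '' T) := by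
  classical
  intro hmem
  -- otherwise `n - 1` elements generate `𝔪`, contradicting Krull's height theorem
  have hspan : Ideal.span (((Finset.univ.erase i).image x : Finset R) : Set R) =
      maximalIdeal R := by
    rw [← hx.1]
    apply le_antisymm
    · refine Ideal.span_mono ?_
      intro w hw
      simp only [Finset.coe_image, Set.mem_image] at hw
      obtain ⟨i, -, rfl⟩ := hw
      exact ⟨i, rfl⟩
    · rw [Ideal.span_le]
      rintro _ ⟨j, rfl⟩
      by_cases hj : j = i
      · subst hj
        refine Ideal.span_mono ?_ hmem
        rintro _ ⟨k, hk, rfl⟩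
        simp only [Finset.coe_image, Set.mem_image]
        exact ⟨k, by simpa using (ne_of_mem_of_not_mem hk hi), rfl⟩
      · refine Ideal.subset_span ?_
        simp only [Finset.coe_image, Set.mem_image]
        exact ⟨j, by simpa using hj, rfl⟩
  have h1 := ringKrullDim_le_spanFinrank_maximalIdeal (R := R)
  rw [hx.2] at h1
  have h2 := Submodule.spanFinrank_span_le_ncard_of_finite (R := R)
    (Finset.finite_toSet ((Finset.univ.erase i).image x))
  have h3 : (maximalIdeal R).spanFinrank ≤ n - 1 := by
    rw [← hspan]
    refine h2.trans ?_
    rw [Set.ncard_coe_finset]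
    refine Finset.card_image_le.trans ?_
    rw [Finset.card_erase_of_mem (Finset.mem_univ i), Finset.card_fin]
  have h4 : n ≤ n - 1 := by
    have : n ≤ (maximalIdeal R).spanFinrank := by exact_mod_cast h1
    omega
  have := i.pos
  omega

open RingTheory.Sequence

lemma IsRegularSystemOfParameters.isWeaklyRegular (hx : IsRegularSystemOfParameters x)
    (l : List (Fin n)) (hl : l.Nodup) : IsWeaklyRegular R (l.map x) := by
  classical
  induction l using List.reverseRecOn with
  | nil => exact IsWeaklyRegular.nil R R
  | append_singleton l i ih =>
    rw [List.nodup_append] at hl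
    rw [List.map_append, isWeaklyRegular_append_iff]
    refine ⟨ih hl.1, ?_⟩
    rw [List.map_singleton, isWeaklyRegular_singleton_iff]
    have hil : i ∉ l.toFinset := by
      intro h
      exact hl.2.2 i (by simpa using h) i (by simp) rfl
    have hI : Ideal.ofList (l.map x) = Ideal.span (x '' l.toFinset) := by
      unfold Ideal.ofList
      congr 1
      ext w
      simp
    have hp := hx.isPrime_span l.toFinset
    rw [smul_eq_mul, Ideal.mul_top, hI, isSMulRegular_iff_right_eq_zero_of_smul]
    intro y hy
    obtain ⟨y, rfl⟩ := Submodule.mkQ_surjective _ y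
    rw [← map_smul, Submodule.mkQ_apply, Submodule.Quotient.mk_eq_zero] at hy
    rw [Submodule.mkQ_apply, Submodule.Quotient.mk_eq_zero]
    exact (hp.mem_or_mem hy).resolve_left (hx.notMem_span hil)

/-- Powers of the members of a regular system of parameters form regular sequences: a member
of the sequence can be moved to the last place, where raising it to a power is harmless. -/
lemma IsRegularSystemOfParameters.isWeaklyRegular_pow (hx : IsRegularSystemOfParameters x)
    (a : Fin n → ℕ) (ha : ∀ i, a i ≠ 0) (l₁ l₂ : List (Fin n)) (hl : (l₁ ++ l₂).Nodup) :
    IsWeaklyRegular R (l₁.map x ++ l₂.map fun i => x i ^ a i) := by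
  induction l₂ generalizing l₁ with
  | nil => simpa using hx.isWeaklyRegular l₁ (by simpa using hl)
  | cons i l ih =>
    have hmem : ∀ r ∈ l₁.map x ++ l.map (fun i => x i ^ a i), r ∈ maximalIdeal R := by
      intro r hr
      rcases List.mem_append.1 hr with hr | hr
      · obtain ⟨j, -, rfl⟩ := List.mem_map.1 hr
        exact hx.mem_maximalIdeal j
      · obtain ⟨j, -, rfl⟩ := List.mem_map.1 hr
        exact Ideal.pow_mem_of_mem _ (hx.mem_maximalIdeal j) _ (Nat.pos_of_ne_zero (ha j))
    have h1 := ih (l₁ ++ [i]) (by simpa using hl)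
    have hperm : List.Perm ((l₁ ++ [i]).map x ++ l.map fun i => x i ^ a i)
        ((l₁.map x ++ l.map fun i => x i ^ a i) ++ [x i]) := by
      simp only [List.map_append, List.map_cons, List.map_nil, List.append_assoc]
      exact List.Perm.append_left _ List.perm_append_comm
    have h2 := IsLocalRing.isWeaklyRegular_of_perm_of_subset_maximalIdeal h1 hperm (by
      intro r hr
      rcases List.mem_append.1 (hperm.mem_iff.1 hr) with hr | hr
      · exact hmem r hr
      · rw [List.mem_singleton.1 hr]; exact hx.mem_maximalIdeal i)
    rw [isWeaklyRegular_append_iff, isWeaklyRegular_singleton_iff] at h2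
    have h3 : IsWeaklyRegular R
        ((l₁.map x ++ l.map fun i => x i ^ a i) ++ [x i ^ a i]) := by
      rw [isWeaklyRegular_append_iff, isWeaklyRegular_singleton_iff]
      exact ⟨h2.1, h2.2.pow _⟩
    refine IsLocalRing.isWeaklyRegular_of_perm_of_subset_maximalIdeal h3 ?_ ?_
    · simp only [List.map_cons, List.append_assoc]
      exact List.Perm.append_left _ List.perm_append_comm
    · intro r hr
      rcases List.mem_append.1 hr with hr | hr
      · exact hmem r hr
      · rw [List.mem_singleton.1 hr]
        exact Ideal.pow_mem_of_mem _ (hx.mem_maximalIdeal i) _ (Nat.pos_of_ne_zero (ha i))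

/-- The elements `x₁, …, xₙ` are *monomially independent* if no monomial `x^v` lies in the
ideal generated by the powers `xᵢ^(vᵢ + 1)`. -/
def MonomiallyIndependent {R : Type*} [CommRing R] {n : ℕ} (x : Fin n → R) : Prop :=
  ∀ v : Fin n →₀ ℕ, ∏ i, x i ^ v i ∉ Ideal.span (Set.range fun i => x i ^ (v i + 1))

theorem IsRegularSystemOfParameters.monomiallyIndependent
    (hx : IsRegularSystemOfParameters x) : MonomiallyIndependent x := by
  classical
  intro v
  induction hd : v.degree generalizing v with
  | zero =>
    have hv : v = 0 := (Finsupp.degree_eq_zero_iff v).1 hd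
    subst hv
    have : Ideal.span (Set.range fun i => x i ^ ((0 : Fin n →₀ ℕ) i + 1)) = maximalIdeal R := by
      rw [← hx.1]; simp
    rw [this]
    simp
  | succ d ih =>
    intro hmem
    obtain ⟨i, hi⟩ : ∃ i, v i ≠ 0 := by
      by_contra! hcon
      have : v = 0 := by ext i; simpa using hcon i
      simp [this] at hd
    let w : Fin n →₀ ℕ := v - Finsupp.single i 1
    have hvw : v = w + Finsupp.single i 1 := by
      refine (tsub_add_cancel_of_le ?_).symm
      rw [Finsupp.single_le_iff]; omega
    have hwd : w.degree = d := by
      rw [hvw, map_add, Finsupp.degree_single] at hd; omega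
    have hwi : v i = w i + 1 := by rw [hvw]; simp
    have hwj : ∀ j, j ≠ i → v j = w j := by
      intro j hj; rw [hvw]; simp [hj.symm]
    apply ih w hwd
    -- split off the generator with index `i`; `xᵢ` is regular modulo the other generators
    let l : List (Fin n) := (Finset.univ.erase i).toList
    have hreg := hx.isWeaklyRegular_pow (fun j => if j = i then 1 else v j + 1)
      (by intro j; split_ifs <;> simp) [] (l ++ [i]) (by
      simp only [List.nil_append]
      rw [List.nodup_append]
      refine ⟨Finset.nodup_toList _, by simp, ?_⟩
      intro a ha b hb
      simp only [l, Finset.mem_toList, Finset.mem_erase, List.mem_singleton] at ha hb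
      rw [hb]; exact ha.1)
    simp only [List.map_nil, List.nil_append, List.map_append, List.map_singleton] at hreg
    rw [isWeaklyRegular_append_iff, isWeaklyRegular_singleton_iff] at hreg
    set J : Ideal R := Ideal.span ((fun j => x j ^ (v j + 1)) '' {j | j ≠ i}) with hJ
    have hofList : Ideal.ofList (l.map fun j => x j ^ (if j = i then 1 else v j + 1)) = J := by
      unfold Ideal.ofList
      congr 1
      ext y
      simp only [l, List.mem_map, Finset.mem_toList, Finset.mem_erase, Set.mem_ofPred_eq,
        Set.mem_image]
      constructor
      · rintro ⟨j, hj, rfl⟩; exact ⟨j, hj.1, by simp [hj.1]⟩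
      · rintro ⟨j, hj, rfl⟩; exact ⟨j, ⟨hj, Finset.mem_univ _⟩, by simp [hj]⟩
    have hNZD : ∀ y, x i * y ∈ J → y ∈ J := by
      intro y hy
      have h1 := hreg.2
      rw [smul_eq_mul, Ideal.mul_top, hofList, isSMulRegular_iff_right_eq_zero_of_smul] at h1
      have h2 := h1 (Submodule.Quotient.mk y) (by
        rw [if_pos trivial, pow_one, ← Submodule.Quotient.mk_smul, Submodule.Quotient.mk_eq_zero]
        exact hy)
      rwa [Submodule.Quotient.mk_eq_zero] at h2
    have hset : (Set.range fun j => x j ^ (v j + 1)) =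
        insert (x i ^ (v i + 1)) ((fun j => x j ^ (v j + 1)) '' {j | j ≠ i}) := by
      rw [← Set.image_univ, ← Set.image_insert_eq (f := fun j => x j ^ (v j + 1))]
      congr 1
      ext j; simp [em]
    rw [hset, Ideal.mem_span_insert] at hmem
    obtain ⟨c, z, hz, hcz⟩ := hmem
    have hprod : ∏ j, x j ^ v j = x i * ∏ j, x j ^ w j := by
      rw [hvw]
      simp only [Finsupp.add_apply, pow_add, Finset.prod_mul_distrib]
      rw [mul_comm]
      congr 1
      rw [Finset.prod_eq_single i] <;> simp +contextual [eq_comm]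
    have hdiff : ∏ j, x j ^ w j - c * x i ^ (w i + 1) ∈ J := by
      apply hNZD
      have : x i * (∏ j, x j ^ w j - c * x i ^ (w i + 1)) = z := by
        rw [mul_sub, ← hprod, hcz, hwi]; ring
      rw [this]; exact hz
    have hJle : J ≤ Ideal.span (Set.range fun j => x j ^ (w j + 1)) := by
      rw [Ideal.span_le]
      rintro _ ⟨j, hj, rfl⟩
      refine Ideal.subset_span ⟨j, ?_⟩
      simp only
      rw [hwj j hj]
    have := add_mem (hJle hdiff) (Ideal.mul_mem_left _ c (Ideal.subset_span ⟨i, rfl⟩))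
    simpa using this

end Regular

/-! ### Monomial ideals and expansions -/

section MonomialIdeal

open IsLocalRing MvPolynomial

variable {S : Type*} [CommRing S] {n : ℕ}

/-- The monomial `x^α`. -/
def monomialAt (x : Fin n → S) (α : Fin n →₀ ℕ) : S := ∏ i, x i ^ α i

/-- The ideal generated by the monomials `x^α` with `α ∈ T`. -/
def monomialIdeal (x : Fin n → S) (T : Set (Fin n →₀ ℕ)) : Ideal S :=
  Ideal.span (monomialAt x '' T)

variable {x : Fin n → S}

lemma monomialAt_add (α β : Fin n →₀ ℕ) :
    monomialAt x (α + β) = monomialAt x α * monomialAt x β := by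
  simp [monomialAt, pow_add, Finset.prod_mul_distrib]

lemma monomialAt_zero : monomialAt x 0 = 1 := by simp [monomialAt]

lemma monomialAt_single (i : Fin n) : monomialAt x (Finsupp.single i 1) = x i := by
  rw [monomialAt, Finset.prod_eq_single i] <;> simp +contextual [eq_comm]

lemma eval_eq_sum_monomialAt (p : MvPolynomial (Fin n) S) :
    eval x p = ∑ α ∈ p.support, p.coeff α * monomialAt x α := eval_eq' x p

lemma monomialAt_mem {T : Set (Fin n →₀ ℕ)} {α : Fin n →₀ ℕ} (h : α ∈ T) :
    monomialAt x α ∈ monomialIdeal x T := Ideal.subset_span ⟨α, h, rfl⟩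

lemma monomialIdeal_mono {T T' : Set (Fin n →₀ ℕ)} (h : T ⊆ T') :
    monomialIdeal x T ≤ monomialIdeal x T' := Ideal.span_mono (Set.image_mono h)

lemma eval_mem_monomialIdeal {T : Set (Fin n →₀ ℕ)} {p : MvPolynomial (Fin n) S}
    (h : ∀ α ∈ p.support, α ∈ T) : eval x p ∈ monomialIdeal x T := by
  rw [eval_eq_sum_monomialAt]
  exact Ideal.sum_mem _ fun α hα => Ideal.mul_mem_left _ _ (monomialAt_mem (h α hα))

lemma exists_eval_of_mem_monomialIdeal {T : Set (Fin n →₀ ℕ)} {r : S}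
    (h : r ∈ monomialIdeal x T) :
    ∃ p : MvPolynomial (Fin n) S, (∀ α ∈ p.support, α ∈ T) ∧ eval x p = r := by
  classical
  induction h using Submodule.span_induction with
  | mem r hr =>
    obtain ⟨α, hα, rfl⟩ := hr
    refine ⟨monomial α 1, fun β hβ => ?_, ?_⟩
    · have := support_monomial_subset hβ
      rw [Finset.mem_singleton] at this
      rwa [this]
    · rw [eval_monomial, one_mul, monomialAt, Finsupp.prod_fintype _ _ (by simp)]
  | zero => exact ⟨0, by simp, by simp⟩
  | add r s _ _ hr hs =>
    obtain ⟨p, hp, rfl⟩ := hr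
    obtain ⟨q, hq, rfl⟩ := hs
    refine ⟨p + q, fun α hα => ?_, by simp⟩
    rcases Finset.mem_union.1 (support_add hα) with h | h
    exacts [hp α h, hq α h]
  | smul c r _ hr =>
    obtain ⟨p, hp, rfl⟩ := hr
    refine ⟨C c * p, fun α hα => hp α ?_, by simp⟩
    rw [mem_support_iff, coeff_C_mul] at hα
    exact mem_support_iff.2 fun h => hα (by rw [h, mul_zero])

lemma mul_mem_monomialIdeal {T₁ T₂ T : Set (Fin n →₀ ℕ)}
    (h : ∀ α ∈ T₁, ∀ β ∈ T₂, α + β ∈ T) {r s : S} (hr : r ∈ monomialIdeal x T₁)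
    (hs : s ∈ monomialIdeal x T₂) : r * s ∈ monomialIdeal x T := by
  have hle : monomialIdeal x T₁ * monomialIdeal x T₂ ≤ monomialIdeal x T := by
    rw [monomialIdeal, monomialIdeal, Ideal.span_mul_span', Ideal.span_le]
    rintro _ ⟨_, ⟨α, hα, rfl⟩, _, ⟨β, hβ, rfl⟩, rfl⟩
    simp only
    rw [← monomialAt_add]
    exact monomialAt_mem (h α hα β hβ)
  exact hle (Ideal.mul_mem_mul hr hs)

lemma span_range_eq_monomialIdeal :
    Ideal.span (Set.range x) = monomialIdeal x {α | α.degree = 1} := by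
  apply le_antisymm
  · rw [Ideal.span_le]
    rintro _ ⟨i, rfl⟩
    rw [← monomialAt_single (x := x) i]
    exact monomialAt_mem (by simp)
  · rw [monomialIdeal, Ideal.span_le]
    rintro _ ⟨α, hα, rfl⟩
    rw [← Finsupp.range_single_one] at hα
    obtain ⟨i, rfl⟩ := hα
    rw [monomialAt_single]
    exact Ideal.subset_span ⟨i, rfl⟩

lemma pow_le_monomialIdeal (N : ℕ) :
    Ideal.span (Set.range x) ^ N ≤ monomialIdeal x {α | α.degree = N} := by
  induction N with
  | zero =>
    rw [pow_zero, Ideal.one_eq_top, top_le_iff, Ideal.eq_top_iff_one]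
    have : monomialAt x 0 ∈ monomialIdeal x {α | α.degree = 0} :=
      monomialAt_mem (by simp)
    rwa [monomialAt_zero] at this
  | succ N ih =>
    rw [pow_succ, Ideal.mul_le]
    intro r hr s hs
    rw [span_range_eq_monomialIdeal] at hs
    refine mul_mem_monomialIdeal ?_ (ih hr) hs
    intro α hα β hβ
    change (α + β).degree = N + 1
    rw [map_add, show α.degree = N from hα, show β.degree = 1 from hβ]

lemma monomialAt_mem_pow {α : Fin n →₀ ℕ} {N : ℕ} (h : N ≤ α.degree) :
    monomialAt x α ∈ Ideal.span (Set.range x) ^ N := by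
  refine Ideal.pow_le_pow_right h ?_
  rw [Finsupp.degree_eq_sum, monomialAt, ← Finset.prod_pow_eq_pow_sum]
  exact Ideal.prod_mem_prod fun i _ => Ideal.pow_mem_pow (Ideal.subset_span (Set.mem_range_self i)) _

lemma monomialIdeal_le_pow {T : Set (Fin n →₀ ℕ)} {N : ℕ} (h : ∀ α ∈ T, N ≤ α.degree) :
    monomialIdeal x T ≤ Ideal.span (Set.range x) ^ N := by
  rw [monomialIdeal, Ideal.span_le]
  rintro _ ⟨α, hα, rfl⟩
  exact monomialAt_mem_pow (h α hα)

/-! ### Monomial independence and the invariants of an expansion -/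

/-- For monomially independent elements, a monomial lies in a monomial ideal only for the
evident reason. -/
lemma MonomiallyIndependent.mem_of_monomialAt_mem (hx : MonomiallyIndependent x)
    {T : Set (Fin n →₀ ℕ)} (hT : IsUpperSet T) {v : Fin n →₀ ℕ}
    (h : monomialAt x v ∈ monomialIdeal x T) : v ∈ T := by
  by_contra hv
  refine hx v ?_
  refine (Ideal.span_le.2 ?_ : monomialIdeal x T ≤ _) h
  rintro _ ⟨α, hα, rfl⟩
  obtain ⟨i, hi⟩ : ∃ i, v i < α i := by
    by_contra! hcon
    exact hv (hT (show α ≤ v from hcon) hα)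
  refine Ideal.mem_of_dvd _ ?_ (Ideal.subset_span ⟨i, rfl⟩)
  exact (pow_dvd_pow _ hi).trans (Finset.dvd_prod_of_mem (fun j => x j ^ α j) (Finset.mem_univ i))

lemma isUnit_coeff_of_mem_support {g : S} {b : MvPolynomial (Fin n) S} (hb : IsExpansion x g b)
    {v : Fin n →₀ ℕ} (hv : v ∈ b.support) : IsUnit (b.coeff v) :=
  (hb.1 v).resolve_left (mem_support_iff.1 hv)

/-- An element lies in a monomial ideal iff all the exponents of one of its expansions do. -/
lemma MonomiallyIndependent.support_subset (hx : MonomiallyIndependent x) {g : S}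
    {b : MvPolynomial (Fin n) S} (hb : IsExpansion x g b) {T : Set (Fin n →₀ ℕ)}
    (hT : IsUpperSet T) (hg : g ∈ monomialIdeal x T) : (b.support : Set (Fin n →₀ ℕ)) ⊆ T := by
  classical
  by_contra hcon
  obtain ⟨w, hw, hwT⟩ := Set.not_subset.1 hcon
  -- a minimal exponent outside `T`
  obtain ⟨v, hv⟩ := (b.support.filter (· ∉ T)).exists_minimal
    ⟨w, Finset.mem_filter.2 ⟨hw, hwT⟩⟩
  have hvs : v ∈ b.support := (Finset.mem_filter.1 hv.1).1
  have hvT : v ∉ T := (Finset.mem_filter.1 hv.1).2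
  let T' : Set (Fin n →₀ ℕ) := T ∪ {β | ∃ α ∈ b.support, α ≠ v ∧ α ≤ β}
  have hT' : IsUpperSet T' := by
    rintro β γ hle (hβ | ⟨α, hα, hne, hαβ⟩)
    · exact Or.inl (hT hle hβ)
    · exact Or.inr ⟨α, hα, hne, hαβ.trans hle⟩
  have hmem : monomialAt x v ∈ monomialIdeal x T' := by
    have hu := isUnit_coeff_of_mem_support hb hvs
    rw [← Ideal.unit_mul_mem_iff_mem _ hu]
    have h1 : b.coeff v * monomialAt x v =
        g - ∑ α ∈ b.support.erase v, b.coeff α * monomialAt x α := by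
      rw [← hb.2, eval_eq_sum_monomialAt, ← Finset.add_sum_erase _ _ hvs]; ring
    rw [h1]
    refine sub_mem (monomialIdeal_mono Set.subset_union_left hg) (Ideal.sum_mem _ fun α hα => ?_)
    exact Ideal.mul_mem_left _ _ (monomialAt_mem (Or.inr ⟨α, Finset.mem_of_mem_erase hα,
      Finset.ne_of_mem_erase hα, le_rfl⟩))
  rcases hx.mem_of_monomialAt_mem hT' hmem with h | ⟨α, hα, hne, hle⟩
  · exact hvT h
  · by_cases hαT : α ∈ T
    · exact hvT (hT hle hαT)
    · exact hne (le_antisymm hle (hv.2 (Finset.mem_filter.2 ⟨hα, hαT⟩) hle))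

/-- Every exponent of an expansion dominates an exponent of any other expansion. -/
lemma MonomiallyIndependent.exists_le (hx : MonomiallyIndependent x) {g : S}
    {b b' : MvPolynomial (Fin n) S} (hb : IsExpansion x g b) (hb' : IsExpansion x g b')
    {v : Fin n →₀ ℕ} (hv : v ∈ b.support) : ∃ w ∈ b'.support, w ≤ v := by
  have hT : IsUpperSet {β | ∃ w ∈ b'.support, w ≤ β} := by
    rintro β γ hle ⟨w, hw, hwβ⟩
    exact ⟨w, hw, hwβ.trans hle⟩
  refine hx.support_subset hb hT ?_ hv
  rw [← hb'.2]
  exact eval_mem_monomialIdeal fun α hα => ⟨α, hα, le_rfl⟩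

/-- At a common minimal exponent, two expansions have coefficients with the same residue. -/
lemma MonomiallyIndependent.residue_coeff_eq [IsLocalRing S] (hx : MonomiallyIndependent x)
    {g : S} {b b' : MvPolynomial (Fin n) S} (hb : IsExpansion x g b) (hb' : IsExpansion x g b')
    {v : Fin n →₀ ℕ} (hv : v ∈ b.support) (hv' : v ∈ b'.support)
    (hmin : ∀ w ∈ b.support, w ≤ v → w = v) (hmin' : ∀ w ∈ b'.support, w ≤ v → w = v) :
    residue S (b.coeff v) = residue S (b'.coeff v) := by
  classical
  by_contra hne
  rw [← sub_eq_zero, ← map_sub, residue_eq_zero_iff] at hne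
  have hu : IsUnit (b.coeff v - b'.coeff v) := by simpa [mem_maximalIdeal] using hne
  let T : Set (Fin n →₀ ℕ) := {β | ∃ w ∈ b.support ∪ b'.support, w ≠ v ∧ w ≤ β}
  have hT : IsUpperSet T := by
    rintro β γ hle ⟨w, hw, hne, hwβ⟩
    exact ⟨w, hw, hne, hwβ.trans hle⟩
  have hmem : monomialAt x v ∈ monomialIdeal x T := by
    rw [← Ideal.unit_mul_mem_iff_mem _ hu]
    have h1 : (b.coeff v - b'.coeff v) * monomialAt x v =
        ∑ α ∈ b'.support.erase v, b'.coeff α * monomialAt x α -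
        ∑ α ∈ b.support.erase v, b.coeff α * monomialAt x α := by
      have e1 := hb.2
      have e2 := hb'.2
      rw [eval_eq_sum_monomialAt, ← Finset.add_sum_erase _ _ hv] at e1
      rw [eval_eq_sum_monomialAt, ← Finset.add_sum_erase _ _ hv'] at e2
      rw [sub_mul, eq_sub_of_add_eq e1, eq_sub_of_add_eq e2]; ring
    rw [h1]
    refine sub_mem (Ideal.sum_mem _ fun α hα => ?_) (Ideal.sum_mem _ fun α hα => ?_)
    · exact Ideal.mul_mem_left _ _ (monomialAt_mem ⟨α, Finset.mem_union_right _
        (Finset.mem_of_mem_erase hα), Finset.ne_of_mem_erase hα, le_rfl⟩)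
    · exact Ideal.mul_mem_left _ _ (monomialAt_mem ⟨α, Finset.mem_union_left _
        (Finset.mem_of_mem_erase hα), Finset.ne_of_mem_erase hα, le_rfl⟩)
  obtain ⟨w, hw, hne, hle⟩ := hx.mem_of_monomialAt_mem hT hmem
  rcases Finset.mem_union.1 hw with h | h
  · exact hne (hmin w h hle)
  · exact hne (hmin' w h hle)

/-! ### Limits and the existence of expansions -/

/-- A Cauchy sequence in a complete ring has a limit. -/
lemma exists_limit {I : Ideal S} [IsPrecomplete I S] (f : ℕ → S)
    (hf : ∀ N, ∃ K, ∀ k ≥ K, f (k + 1) - f k ∈ I ^ N) :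
    ∃ L, ∀ N, ∃ K, ∀ k ≥ K, L - f k ∈ I ^ N := by
  choose K hK using hf
  have hcauchy : ∀ N k l, K N ≤ k → k ≤ l → f l - f k ∈ I ^ N := by
    intro N k l hk hkl
    induction l, hkl using Nat.le_induction with
    | base => simp
    | succ l hl ih =>
      have := add_mem (hK N l (hk.trans hl)) ih
      simpa using this
  let M : ℕ → ℕ := fun N => ∑ j ∈ Finset.range (N + 1), K j
  have hM : ∀ N, K N ≤ M N := fun N =>
    Finset.single_le_sum (f := K) (fun _ _ => Nat.zero_le _) (Finset.self_mem_range_succ N)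
  have hMmono : ∀ {m l}, m ≤ l → M m ≤ M l := fun {m l} h =>
    Finset.sum_le_sum_of_subset (Finset.range_mono (by omega))
  obtain ⟨L, hL⟩ := IsPrecomplete.prec (I := I) (M := S) inferInstance (f := fun N => f (M N))
    (fun {m l} h => by
      rw [SModEq.sub_mem, smul_eq_mul, Ideal.mul_top, ← neg_mem_iff, neg_sub]
      exact hcauchy m _ _ (hM m) (hMmono h))
  refine ⟨L, fun N => ⟨M N, fun k hk => ?_⟩⟩
  have h1 := hL N
  rw [SModEq.sub_mem, smul_eq_mul, Ideal.mul_top] at h1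
  have h2 := hcauchy N _ _ (hM N) hk
  have := neg_mem (add_mem h1 h2)
  convert this using 1
  ring

lemma eq_zero_of_forall_mem_pow {I : Ideal S} [IsHausdorff I S] {r : S}
    (h : ∀ N, r ∈ I ^ N) : r = 0 :=
  IsHausdorff.haus (I := I) inferInstance r fun N => by
    rw [SModEq.sub_mem, smul_eq_mul, Ideal.mul_top, sub_zero]; exact h N

variable [IsLocalRing S]

/-- Modulo `𝔪^(N + 1)`, an element of `𝔪^N` is a form of degree `N` with unit coefficients. -/
lemma exists_form_of_mem_pow (hx : Ideal.span (Set.range x) = maximalIdeal S) {N : ℕ} {r : S}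
    (hr : r ∈ maximalIdeal S ^ N) :
    ∃ p : MvPolynomial (Fin n) S, (∀ α ∈ p.support, α.degree = N ∧ IsUnit (p.coeff α)) ∧
      r - eval x p ∈ maximalIdeal S ^ (N + 1) := by
  classical
  rw [← hx] at hr
  obtain ⟨q, hq, rfl⟩ := exists_eval_of_mem_monomialIdeal (pow_le_monomialIdeal N hr)
  let s := q.support.filter fun α => IsUnit (q.coeff α)
  refine ⟨∑ α ∈ s, monomial α (q.coeff α), ?_, ?_⟩
  · have hcoeff : ∀ α, (∑ β ∈ s, monomial β (q.coeff β)).coeff α =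
        if α ∈ s then q.coeff α else 0 := by
      intro α
      rw [coeff_sum]
      simp [coeff_monomial]
    intro α hα
    rw [mem_support_iff, hcoeff] at hα
    have hαs : α ∈ s := by by_contra h; simp [h] at hα
    rw [hcoeff, if_pos hαs]
    exact ⟨hq α (Finset.mem_filter.1 hαs).1, (Finset.mem_filter.1 hαs).2⟩
  · have h1 : eval x (∑ α ∈ s, monomial α (q.coeff α)) =
        ∑ α ∈ s, q.coeff α * monomialAt x α := by
      rw [map_sum]
      refine Finset.sum_congr rfl fun α _ => ?_
      rw [eval_monomial, monomialAt, Finsupp.prod_fintype _ _ (by simp)]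
    rw [h1, eval_eq_sum_monomialAt, ← Finset.sum_filter_add_sum_filter_not q.support
      (fun α => IsUnit (q.coeff α)), add_sub_cancel_left]
    refine Ideal.sum_mem _ fun α hα => ?_
    rw [Finset.mem_filter] at hα
    rw [pow_succ', ← hx]
    refine Ideal.mul_mem_mul ?_ (monomialAt_mem_pow (le_of_eq (hq α hα.1).symm))
    rw [hx]; exact (mem_maximalIdeal _).2 hα.2

/-- In a complete local ring every element has a (finite) expansion. It is a formal sum
`∑ a_α x^α` over all exponents; by Dickson's lemma the terms can be collected at the finitely
many minimal exponents `v`, where they add up to a unit times `x^v`. -/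
theorem exists_isExpansion [IsAdicComplete (maximalIdeal S) S]
    (hx : Ideal.span (Set.range x) = maximalIdeal S) (r : S) :
    ∃ b, IsExpansion x r b := by
  classical
  have hstep : ∀ (N : ℕ) (r : S), ∃ p : MvPolynomial (Fin n) S, r ∈ maximalIdeal S ^ N →
      (∀ α ∈ p.support, α.degree = N ∧ IsUnit (p.coeff α)) ∧
      r - eval x p ∈ maximalIdeal S ^ (N + 1) := by
    intro N r
    by_cases hr : r ∈ maximalIdeal S ^ N
    · obtain ⟨p, hp⟩ := exists_form_of_mem_pow hx hr
      exact ⟨p, fun _ => hp⟩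
    · exact ⟨0, fun h => absurd h hr⟩
  choose F hF using hstep
  let rem : ℕ → S := fun N => Nat.rec r (fun N s => s - eval x (F N s)) N
  have hrem0 : rem 0 = r := rfl
  have hremS : ∀ N, rem (N + 1) = rem N - eval x (F N (rem N)) := fun N => rfl
  have hrem : ∀ N, rem N ∈ maximalIdeal S ^ N := by
    intro N
    induction N with
    | zero => simp
    | succ N ih => rw [hremS]; exact (hF N _ ih).2
  let p : ℕ → MvPolynomial (Fin n) S := fun N => F N (rem N)
  have hp : ∀ N, ∀ α ∈ (p N).support, α.degree = N ∧ IsUnit ((p N).coeff α) :=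
    fun N => (hF N _ (hrem N)).1
  have hsum : ∀ N, rem N = r - ∑ k ∈ Finset.range N, eval x (p k) := by
    intro N
    induction N with
    | zero => simp [hrem0]
    | succ N ih => rw [hremS, Finset.sum_range_succ, ih]; simp only [p, ih]; ring
  let B : Set (Fin n →₀ ℕ) := {α | α ∈ (p α.degree).support}
  have hB : ∀ N, ∀ α ∈ (p N).support, α ∈ B := by
    intro N α hα
    change α ∈ (p α.degree).support
    rwa [(hp N α hα).1]
  let M : Set (Fin n →₀ ℕ) := {v | Minimal (· ∈ B) v}
  have hMfin : M.Finite :=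
    WellQuasiOrderedLE.finite_of_isAntichain (setOfPred_minimal_antichain _)
  have hmin : ∀ α, ∃ v, α ∈ B → v ≤ α ∧ v ∈ M := by
    intro α
    by_cases hα : α ∈ B
    · obtain ⟨v, hv, hvM⟩ := exists_minimal_le_of_wellFoundedLT (· ∈ B) α hα
      exact ⟨v, fun _ => ⟨hv, hvM⟩⟩
    · exact ⟨0, fun h => absurd h hα⟩
  choose m hm using hmin
  -- the part of degree `k` of the cofactor of `x^v`
  let c : ℕ → (Fin n →₀ ℕ) → S := fun k v =>
    ∑ α ∈ (p k).support.filter (m · = v), (p k).coeff α * monomialAt x (α - v)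
  have hc : ∀ k, eval x (p k) = ∑ v ∈ hMfin.toFinset, monomialAt x v * c k v := by
    intro k
    rw [eval_eq_sum_monomialAt,
      ← Finset.sum_fiberwise_of_maps_to (t := hMfin.toFinset) (g := m)
        (fun α hα => by simpa using (hm α (hB k α hα)).2)]
    refine Finset.sum_congr rfl fun v _ => ?_
    rw [Finset.mul_sum]
    refine Finset.sum_congr rfl fun α hα => ?_
    obtain ⟨hαs, rfl⟩ := Finset.mem_filter.1 hα
    have hle := (hm α (hB k α hαs)).1
    conv_lhs => rw [← add_tsub_cancel_of_le hle, monomialAt_add, add_tsub_cancel_of_le hle]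
    ring
  have hcmem : ∀ v N k, N + v.degree ≤ k → c k v ∈ maximalIdeal S ^ N := by
    intro v N k hk
    refine Ideal.sum_mem _ fun α hα => Ideal.mul_mem_left _ _ ?_
    obtain ⟨hαs, rfl⟩ := Finset.mem_filter.1 hα
    rw [← hx]
    apply monomialAt_mem_pow
    have hle := (hm α (hB k α hαs)).1
    have h1 : (m α + (α - m α)).degree = α.degree := by rw [add_tsub_cancel_of_le hle]
    rw [map_add, (hp k α hαs).1] at h1
    omega
  have hlim : ∀ v, ∃ u, ∀ N, ∃ K, ∀ k ≥ K,
      u - ∑ j ∈ Finset.range k, c j v ∈ maximalIdeal S ^ N := by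
    intro v
    refine exists_limit _ fun N => ⟨N + v.degree, fun k hk => ?_⟩
    rw [Finset.sum_range_succ, add_sub_cancel_left]
    exact hcmem v N k hk
  choose u hu using hlim
  have hunit : ∀ v ∈ M, IsUnit (u v) := by
    intro v hv
    obtain ⟨K, hK⟩ := hu v 1
    have h1 := hK (K + v.degree + 1) (by omega)
    rw [pow_one] at h1
    have h2 : ∀ k, k ≠ v.degree → c k v ∈ maximalIdeal S := by
      intro k hk
      rcases lt_or_gt_of_ne hk with hlt | hgt
      · have : c k v = 0 := by
          refine Finset.sum_eq_zero fun α hα => ?_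
          exfalso
          obtain ⟨hαs, rfl⟩ := Finset.mem_filter.1 hα
          have hle := (hm α (hB k α hαs)).1
          have h3 := Finsupp.degree_mono hle
          rw [(hp k α hαs).1] at h3
          omega
        rw [this]; exact zero_mem _
      · simpa using hcmem v 1 k (by omega)
    have hvs : v ∈ (p v.degree).support := hv.1
    have h3 : c v.degree v = (p v.degree).coeff v := by
      have : (p v.degree).support.filter (m · = v) = {v} := by
        ext α
        rw [Finset.mem_filter, Finset.mem_singleton]
        constructor
        · rintro ⟨hα, rfl⟩
          have hle := (hm α (hB _ α hα)).1
          have hd := (hp _ α hα).1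
          have h4 : (m α + (α - m α)).degree = α.degree := by rw [add_tsub_cancel_of_le hle]
          rw [map_add, hd] at h4
          have h5 : α - m α = 0 := (Finsupp.degree_eq_zero_iff _).1 (by omega)
          exact le_antisymm (tsub_eq_zero_iff_le.1 h5) hle
        · rintro rfl
          refine ⟨hvs, ?_⟩
          have h4 := hm α hv.1
          exact le_antisymm h4.1 (hv.2 h4.2.1 h4.1)
      simp only [c]
      rw [this, Finset.sum_singleton, tsub_self, monomialAt_zero, mul_one]
    have hcu : IsUnit (c v.degree v) := by rw [h3]; exact (hp _ v hvs).2
    rw [Finset.range_eq_Ico, ← Finset.range_eq_Ico, ← Finset.add_sum_erase _ _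
      (Finset.mem_range.2 (show v.degree < K + v.degree + 1 by omega))] at h1
    have h5 : ∑ j ∈ (Finset.range (K + v.degree + 1)).erase v.degree, c j v ∈ maximalIdeal S :=
      Ideal.sum_mem _ fun j hj => h2 j (Finset.ne_of_mem_erase hj)
    have h6 : u v - c v.degree v ∈ maximalIdeal S := by
      have := add_mem h1 h5
      convert this using 1
      ring
    by_contra hnu
    have h7 := sub_mem ((mem_maximalIdeal _).2 hnu) h6
    rw [sub_sub_cancel] at h7
    exact (mem_maximalIdeal _).1 h7 hcu
  refine ⟨∑ v ∈ hMfin.toFinset, monomial v (u v), fun α => ?_, ?_⟩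
  · rw [coeff_sum]
    by_cases hα : α ∈ M
    · right
      rw [Finset.sum_eq_single α]
      · simpa [coeff_monomial] using hunit α hα
      · intro v _ hv; simp [coeff_monomial, hv]
      · intro h; exact absurd (by simpa using hα) h
    · left
      refine Finset.sum_eq_zero fun v hv => ?_
      have : v ≠ α := by rintro rfl; exact hα (by simpa using hv)
      simp [coeff_monomial, this]
  · rw [map_sum, ← sub_eq_zero]
    apply eq_zero_of_forall_mem_pow (I := maximalIdeal S)
    intro N
    choose K hK using fun v => hu v N
    let L := N + ∑ v ∈ hMfin.toFinset, K v
    have h1 : ∑ v ∈ hMfin.toFinset, eval x (monomial v (u v)) - r =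
        ∑ v ∈ hMfin.toFinset, monomialAt x v * (u v - ∑ j ∈ Finset.range L, c j v) - rem L := by
      rw [hsum L]
      simp only [hc, mul_sub, Finset.sum_sub_distrib, Finset.mul_sum]
      rw [Finset.sum_comm]
      have : ∀ v, eval x (monomial v (u v)) = monomialAt x v * u v := by
        intro v
        rw [eval_monomial, monomialAt, Finsupp.prod_fintype _ _ (by simp), mul_comm]
      simp only [this]
      ring
    rw [h1]
    refine sub_mem (Ideal.sum_mem _ fun v hv => Ideal.mul_mem_left _ _ (hK v L ?_)) ?_
    · have := Finset.single_le_sum (f := K) (fun _ _ => Nat.zero_le _) hv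
      simp only [L]; omega
    · exact Ideal.pow_le_pow_right (by simp only [L]; omega) (hrem L)

end MonomialIdeal

/-! ### Passage to the completion -/

section Completion

open IsLocalRing

variable {R : Type*} [CommRing R] [IsLocalRing R] {n : ℕ} {x : Fin n → R}

lemma span_range_algebraMap_completion [IsNoetherianRing R]
    (hx : Ideal.span (Set.range x) = maximalIdeal R) :
    Ideal.span (Set.range fun i => algebraMap R (Completion R) (x i)) =
      maximalIdeal (Completion R) := by
  have h := congrArg (Ideal.map (algebraMap R (Completion R))) hx
  rw [Ideal.map_span, ← Set.range_comp] at h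
  rw [AdicCompletion.maximalIdeal_eq_map]
  exact h

lemma MonomiallyIndependent.completion (hspan : Ideal.span (Set.range x) = maximalIdeal R)
    (hx : MonomiallyIndependent x) :
    MonomiallyIndependent fun i => algebraMap R (Completion R) (x i) := by
  intro v hv
  apply hx v
  set J : Ideal R := Ideal.span (Set.range fun i => x i ^ (v i + 1)) with hJ
  -- reduce modulo a power of `𝔪` contained in `J`
  let N := v.degree + 1
  have hN : maximalIdeal R ^ N ≤ J := by
    rw [← hspan]
    refine (pow_le_monomialIdeal N).trans ?_
    rw [monomialIdeal, Ideal.span_le]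
    rintro _ ⟨α, hα, rfl⟩
    obtain ⟨i, hi⟩ : ∃ i, v i < α i := by
      by_contra! hcon
      have h1 := Finsupp.degree_mono (show α ≤ v from hcon)
      have h2 : α.degree = N := hα
      omega
    refine Ideal.mem_of_dvd _ ?_ (Ideal.subset_span ⟨i, rfl⟩)
    exact (pow_dvd_pow _ hi).trans
      (Finset.dvd_prod_of_mem (fun j => x j ^ α j) (Finset.mem_univ i))
  let φ := (AdicCompletion.evalₐ (maximalIdeal R) N).toRingHom
  have hφ : ∀ r : R, φ (algebraMap R (Completion R) r) = Ideal.Quotient.mk _ r := fun r =>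
    (AdicCompletion.evalₐ (maximalIdeal R) N).commutes r
  have h1 := Ideal.mem_map_of_mem φ hv
  rw [Ideal.map_span, ← Set.range_comp] at h1
  have h2 : (φ ∘ fun i => algebraMap R (Completion R) (x i) ^ (v i + 1)) =
      (Ideal.Quotient.mk (maximalIdeal R ^ N)) ∘ fun i => x i ^ (v i + 1) := by
    funext i
    simp only [Function.comp_apply, map_pow, hφ]
  rw [h2, Set.range_comp, ← Ideal.map_span, map_prod] at h1
  simp only [map_pow, hφ] at h1
  rw [← hJ] at h1
  obtain ⟨j, hj, hjv⟩ :=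
    (Ideal.mem_map_iff_of_surjective _ Ideal.Quotient.mk_surjective).1 h1
  have h3 : Ideal.Quotient.mk (maximalIdeal R ^ N) (∏ i, x i ^ v i) =
      Ideal.Quotient.mk (maximalIdeal R ^ N) j := by
    rw [hjv, map_prod]
    simp only [map_pow]
  have h4 := hN (Ideal.Quotient.eq.1 h3)
  have := add_mem h4 hj
  simpa using this

end Completion

/-! ### Faces of Newton polyhedra -/

section Polyhedra

open MvPolynomial

variable {n : ℕ}

lemma isLinearMap_dotProduct (ξ : Fin n → ℝ) : IsLinearMap ℝ fun p : Fin n → ℝ => ξ ⬝ᵥ p :=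
  ⟨fun _ _ => dotProduct_add _ _ _, fun _ _ => dotProduct_smul _ _ _⟩

lemma toPoint_add (α β : Fin n →₀ ℕ) : toPoint (α + β) = toPoint α + toPoint β := by
  funext i; simp [toPoint]

lemma toPoint_injective : Function.Injective (toPoint (n := n)) := by
  intro α β h
  ext i
  have h1 : (α i : ℝ) = β i := congrFun h i
  exact_mod_cast h1

lemma toPoint_mono {α β : Fin n →₀ ℕ} (h : α ≤ β) : toPoint α ≤ toPoint β := fun i => by
  simpa [toPoint] using h i

lemma dotProduct_pos_of_pos {ξ v : Fin n → ℝ} (hξ : ∀ i, 0 < ξ i) (hv : 0 ≤ v) (hne : v ≠ 0) :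
    0 < ξ ⬝ᵥ v := by
  obtain ⟨i, hi⟩ := Function.ne_iff.1 hne
  refine Finset.sum_pos' (fun j _ => mul_nonneg (hξ j).le (hv j)) ⟨i, Finset.mem_univ i, ?_⟩
  exact mul_pos (hξ i) (lt_of_le_of_ne (hv i) (Ne.symm hi))

variable {R : Type*} [CommRing R]

lemma newtonPolyhedron_eq (b : MvPolynomial (Fin n) R) :
    newtonPolyhedron b =
      convexHull ℝ (toPoint '' {α | b.coeff α ≠ 0}) + {v : Fin n → ℝ | 0 ≤ v} := by
  rw [newtonPolyhedron, convexHull_add]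
  congr 1
  exact (convex_Ici (0 : Fin n → ℝ)).convexHull_eq

lemma toPoint_mem_newtonPolyhedron {b : MvPolynomial (Fin n) R} {α : Fin n →₀ ℕ}
    (h : b.coeff α ≠ 0) : toPoint α ∈ newtonPolyhedron b :=
  subset_convexHull _ _ ⟨toPoint α, ⟨α, h, rfl⟩, 0, le_refl (0 : Fin n → ℝ), add_zero _⟩

lemma le_dotProduct_of_mem_convexHull {B : Set (Fin n → ℝ)} {ξ p : Fin n → ℝ} {m : ℝ}
    (h : ∀ q ∈ B, m ≤ ξ ⬝ᵥ q) (hp : p ∈ convexHull ℝ B) : m ≤ ξ ⬝ᵥ p :=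
  convexHull_min (s := B) h (convex_halfSpace_ge (isLinearMap_dotProduct ξ) m) hp

lemma mem_convexHull_filter {B : Set (Fin n → ℝ)} {ξ p : Fin n → ℝ} {m : ℝ}
    (h : ∀ q ∈ B, m ≤ ξ ⬝ᵥ q) (hp : p ∈ convexHull ℝ B) (hpm : ξ ⬝ᵥ p = m) :
    p ∈ convexHull ℝ {q ∈ B | ξ ⬝ᵥ q = m} := by
  have hB : B = {q ∈ B | ξ ⬝ᵥ q = m} ∪ {q ∈ B | m < ξ ⬝ᵥ q} := by
    ext q
    constructor
    · intro hq
      rcases (h q hq).eq_or_lt with h1 | h1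
      · exact Or.inl ⟨hq, h1.symm⟩
      · exact Or.inr ⟨hq, h1⟩
    · rintro (hq | hq) <;> exact hq.1
  have hgt : ∀ w ∈ convexHull ℝ {q ∈ B | m < ξ ⬝ᵥ q}, m < ξ ⬝ᵥ w := fun w hw =>
    convexHull_min (s := {q ∈ B | m < ξ ⬝ᵥ q}) (fun q hq => hq.2)
      (convex_halfSpace_gt (isLinearMap_dotProduct ξ) m) hw
  rcases Set.eq_empty_or_nonempty {q ∈ B | ξ ⬝ᵥ q = m} with h0 | h0
  · rw [hB, h0, Set.empty_union] at hp
    exact absurd hpm (hgt p hp).ne'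
  rcases Set.eq_empty_or_nonempty {q ∈ B | m < ξ ⬝ᵥ q} with h1 | h1
  · rw [hB, h1, Set.union_empty] at hp
    exact hp
  rw [hB, convexHull_union h0 h1, mem_convexJoin] at hp
  obtain ⟨u, hu, w, hw, s, t, hs, ht, hst, rfl⟩ := hp
  have hum : m ≤ ξ ⬝ᵥ u := le_dotProduct_of_mem_convexHull (fun q hq => hq.2.ge) hu
  have hwm := hgt w hw
  rw [dotProduct_add, dotProduct_smul, dotProduct_smul, smul_eq_mul, smul_eq_mul] at hpm
  have ht0 : t = 0 := by
    by_contra hne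
    have h2 : 0 < t := lt_of_le_of_ne ht (Ne.symm hne)
    have h3 := mul_lt_mul_of_pos_left hwm h2
    have h4 := mul_le_mul_of_nonneg_left hum hs
    have h5 : s * m + t * m = m := by rw [← add_mul, hst, one_mul]
    linarith
  have hs1 : s = 1 := by linarith
  rw [ht0, hs1, one_smul, zero_smul, add_zero]
  exact hu

/-- For `ξ > 0` the face `Δ^ξ` is the convex hull of the exponents of least weight. -/
lemma faceOf_newtonPolyhedron {b : MvPolynomial (Fin n) R} {ξ : Fin n → ℝ} (hξ : ∀ i, 0 < ξ i)
    {m : ℝ} (hm : ∀ α, b.coeff α ≠ 0 → m ≤ ξ ⬝ᵥ toPoint α)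
    (hex : ∃ α, b.coeff α ≠ 0 ∧ ξ ⬝ᵥ toPoint α = m) :
    faceOf (newtonPolyhedron b) ξ =
      convexHull ℝ (toPoint '' {α | b.coeff α ≠ 0 ∧ ξ ⬝ᵥ toPoint α = m}) := by
  have himage : toPoint '' {α | b.coeff α ≠ 0 ∧ ξ ⬝ᵥ toPoint α = m} =
      {q ∈ toPoint '' {α | b.coeff α ≠ 0} | ξ ⬝ᵥ q = m} := by
    ext q
    constructor
    · rintro ⟨α, ⟨h1, h2⟩, rfl⟩; exact ⟨⟨α, h1, rfl⟩, h2⟩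
    · rintro ⟨⟨α, h1, rfl⟩, h2⟩; exact ⟨α, ⟨h1, h2⟩, rfl⟩
  have hlow : ∀ q ∈ toPoint '' {α | b.coeff α ≠ 0}, m ≤ ξ ⬝ᵥ q := by
    rintro _ ⟨α, hα, rfl⟩; exact hm α hα
  have hnp : ∀ q ∈ newtonPolyhedron b, m ≤ ξ ⬝ᵥ q := by
    intro q hq
    rw [newtonPolyhedron_eq] at hq
    obtain ⟨u, hu, v, hv, rfl⟩ := hq
    simp only
    rw [dotProduct_add]
    have h1 := le_dotProduct_of_mem_convexHull hlow hu
    have h2 : 0 ≤ ξ ⬝ᵥ v := dotProduct_nonneg_of_nonneg (fun i => (hξ i).le) hv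
    linarith
  obtain ⟨α₀, hα₀, hα₀m⟩ := hex
  apply Set.Subset.antisymm
  · rintro p ⟨hp, hpmin⟩
    have hpm : ξ ⬝ᵥ p = m :=
      le_antisymm (hα₀m ▸ hpmin _ (toPoint_mem_newtonPolyhedron hα₀)) (hnp p hp)
    rw [newtonPolyhedron_eq] at hp
    obtain ⟨u, hu, v, hv, rfl⟩ := hp
    simp only at hpm
    rw [dotProduct_add] at hpm
    have h1 := le_dotProduct_of_mem_convexHull hlow hu
    have hv0 : v = 0 := by
      by_contra hne
      have := dotProduct_pos_of_pos hξ hv hne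
      linarith
    rw [hv0, dotProduct_zero, add_zero] at hpm
    simp only [hv0, add_zero]
    rw [himage]
    exact mem_convexHull_filter hlow hu hpm
  · intro p hp
    have hpm : ξ ⬝ᵥ p = m := by
      refine le_antisymm ?_ ?_
      · refine convexHull_min ?_ (convex_halfSpace_le (isLinearMap_dotProduct ξ) m) hp
        rintro _ ⟨α, hα, rfl⟩
        exact hα.2.le
      · refine le_dotProduct_of_mem_convexHull ?_ hp
        rintro _ ⟨α, hα, rfl⟩
        exact hα.2.ge
    refine ⟨convexHull_min ?_ (convex_convexHull ℝ _) hp, fun q hq => hpm ▸ hnp q hq⟩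
    rintro _ ⟨α, hα, rfl⟩
    exact toPoint_mem_newtonPolyhedron hα.1

lemma finite_setOf_coeff_ne_zero (b : MvPolynomial (Fin n) R) : {α | b.coeff α ≠ 0}.Finite :=
  b.support.finite_toSet.subset fun _ hα => mem_support_iff.2 hα

lemma isCompactFace_of_pos {b : MvPolynomial (Fin n) R} {ξ : Fin n → ℝ} (hξ : ∀ i, 0 < ξ i)
    {m : ℝ} (hm : ∀ α, b.coeff α ≠ 0 → m ≤ ξ ⬝ᵥ toPoint α)
    (hex : ∃ α, b.coeff α ≠ 0 ∧ ξ ⬝ᵥ toPoint α = m) :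
    IsCompactFace (newtonPolyhedron b)
      (convexHull ℝ (toPoint '' {α | b.coeff α ≠ 0 ∧ ξ ⬝ᵥ toPoint α = m})) := by
  refine ⟨⟨ξ, fun i => (hξ i).le, (faceOf_newtonPolyhedron hξ hm hex).symm⟩, ?_⟩
  refine Set.Finite.isCompact_convexHull (𝕜 := ℝ) (Set.Finite.image _ ?_)
  exact (finite_setOf_coeff_ne_zero b).subset fun α hα => hα.1

/-- A linear form that cuts out a nonempty compact face has positive coefficients only. -/
lemma pos_of_isCompact_faceOf {b : MvPolynomial (Fin n) R} {ξ : Fin n → ℝ} (hξ : 0 ≤ ξ)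
    (hc : IsCompact (faceOf (newtonPolyhedron b) ξ))
    (hne : (faceOf (newtonPolyhedron b) ξ).Nonempty) (i : Fin n) : 0 < ξ i := by
  refine lt_of_le_of_ne (hξ i) fun h0 => ?_
  obtain ⟨p, hp, hpmin⟩ := hne
  have hray : ∀ t : ℝ, 0 ≤ t → p + Pi.single i t ∈ faceOf (newtonPolyhedron b) ξ := by
    intro t ht
    constructor
    · rw [newtonPolyhedron_eq] at hp ⊢
      obtain ⟨u, hu, v, hv, rfl⟩ := hp
      refine ⟨u, hu, v + Pi.single i t, ?_, by simp only [add_assoc]⟩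
      have : (0 : Fin n → ℝ) ≤ Pi.single i t := Pi.single_nonneg.2 ht
      exact add_nonneg hv this
    · intro q hq
      rw [dotProduct_add, dotProduct_single, ← h0, zero_mul, add_zero]
      exact hpmin q hq
  obtain ⟨C, hC⟩ := (hc.image (continuous_apply i)).isBounded.bddAbove
  have h1 := hC ⟨_, hray (|C - p i| + 1) (by positivity), rfl⟩
  simp only [Pi.add_apply, Pi.single_eq_same] at h1
  have := le_abs_self (C - p i)
  linarith

/-- An exponent on a compact face of the Newton polyhedron is a minimal exponent. -/
lemma eq_of_le_of_toPoint_mem {b : MvPolynomial (Fin n) R} {A : Set (Fin n → ℝ)}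
    (hA : IsCompactFace (newtonPolyhedron b) A) {v w : Fin n →₀ ℕ} (hv : toPoint v ∈ A)
    (hw : b.coeff w ≠ 0) (hwv : w ≤ v) : w = v := by
  obtain ⟨⟨ξ, hξ, rfl⟩, hc⟩ := hA
  have hpos := pos_of_isCompact_faceOf hξ hc ⟨_, hv⟩
  by_contra hne
  have h1 := hv.2 _ (toPoint_mem_newtonPolyhedron hw)
  have h2 := dotProduct_pos_of_pos hpos (sub_nonneg.2 (toPoint_mono hwv)) (by
    rw [sub_ne_zero]; exact fun h => hne (toPoint_injective h).symm)
  rw [dotProduct_sub] at h2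
  linarith

lemma newtonPolyhedron_subset {b b' : MvPolynomial (Fin n) R}
    (h : ∀ v ∈ b.support, ∃ w ∈ b'.support, w ≤ v) :
    newtonPolyhedron b ⊆ newtonPolyhedron b' := by
  refine convexHull_mono ?_
  rintro _ ⟨_, ⟨v, hv, rfl⟩, u, hu, rfl⟩
  obtain ⟨w, hw, hwv⟩ := h v (mem_support_iff.2 hv)
  refine ⟨toPoint w, ⟨w, mem_support_iff.1 hw, rfl⟩, toPoint v - toPoint w + u, ?_, ?_⟩
  · exact add_nonneg (sub_nonneg.2 (toPoint_mono hwv)) hu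
  · simp only; abel

/-- For monomially independent elements, the Newton polyhedron and the symbolic restrictions
to its compact faces do not depend on the expansion. -/
theorem MonomiallyIndependent.hasSymbolicRestriction [IsLocalRing R] {x : Fin n → R}
    (hx : MonomiallyIndependent x) {g : R} {b : MvPolynomial (Fin n) R} (hb : IsExpansion x g b)
    {A : Set (Fin n → ℝ)} (hA : IsCompactFace (newtonPolyhedron b) A) :
    HasSymbolicRestriction x g A (symbolicRestriction b A) := by
  classical
  refine ⟨⟨b, hb⟩, fun b' hb' => ?_⟩
  have hNP : newtonPolyhedron b' = newtonPolyhedron b :=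
    Set.Subset.antisymm (newtonPolyhedron_subset fun v hv => hx.exists_le hb' hb hv)
      (newtonPolyhedron_subset fun v hv => hx.exists_le hb hb' hv)
  have hA' : IsCompactFace (newtonPolyhedron b') A := by rwa [hNP]
  have hsupp : ∀ {c c' : MvPolynomial (Fin n) R}, IsExpansion x g c → IsExpansion x g c' →
      IsCompactFace (newtonPolyhedron c) A → ∀ v, toPoint v ∈ A → v ∈ c.support →
      newtonPolyhedron c' = newtonPolyhedron c → v ∈ c'.support := by
    intro c c' hc hc' hAc v hvA hv heq
    obtain ⟨w, hw, hwv⟩ := hx.exists_le hc hc' hv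
    rw [← heq] at hAc
    rwa [← eq_of_le_of_toPoint_mem hAc hvA (mem_support_iff.1 hw) hwv]
  refine ⟨hA', ?_⟩
  unfold symbolicRestriction
  have hfilter : b'.support.filter (fun α => toPoint α ∈ A) =
      b.support.filter (fun α => toPoint α ∈ A) := by
    ext v
    simp only [Finset.mem_filter]
    exact ⟨fun h => ⟨hsupp hb' hb hA' v h.2 h.1 hNP.symm, h.2⟩,
      fun h => ⟨hsupp hb hb' hA v h.2 h.1 hNP, h.2⟩⟩
  convert Finset.sum_congr hfilter fun v hv => ?_
  rw [Finset.mem_filter] at hv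
  congr 1
  exact hx.residue_coeff_eq hb' hb (hsupp hb hb' hA v hv.2 hv.1 hNP) hv.1
    (fun w hw hwv => eq_of_le_of_toPoint_mem hA' hv.2 (mem_support_iff.1 hw) hwv)
    (fun w hw hwv => eq_of_le_of_toPoint_mem hA hv.2 (mem_support_iff.1 hw) hwv)

end Polyhedra

/-! ### Loose edges -/

section LooseEdge

open MvPolynomial

variable {n : ℕ}

/-- An integral vector, seen in `ℝⁿ`. -/
def realVec (c : Fin n → ℤ) : Fin n → ℝ := fun i => (c i : ℝ)

/-- The direction of a nonzero integral vector is generated by an integral vector `c` such that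
the integral points of `ℝ c` are the integral multiples of `c`. -/
lemma exists_primitive {δ : Fin n → ℤ} (hδ : δ ≠ 0) :
    ∃ c : Fin n → ℤ, c ≠ 0 ∧ (∃ s : ℝ, realVec δ = s • realVec c) ∧
      ∀ v : Fin n → ℤ, (∃ t : ℝ, realVec v = t • realVec c) → ∃ k : ℤ, v = k • c := by
  classical
  obtain ⟨i, hi⟩ := Function.ne_iff.1 hδ
  have hi : δ i ≠ 0 := hi
  -- a vector on the line `ℝ δ` with the least positive absolute value of the `i`-th coordinate
  have hex : ∃ k : ℕ, 0 < k ∧ ∃ v : Fin n → ℤ, (v i).natAbs = k ∧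
      ∃ t : ℝ, realVec v = t • realVec δ :=
    ⟨(δ i).natAbs, Int.natAbs_pos.2 hi, δ, rfl, 1, by rw [one_smul]⟩
  obtain ⟨hpos, c, hck, t, hct⟩ := Nat.find_spec hex
  have hmin := fun k (h : k < Nat.find hex) => Nat.find_min hex h
  rw [← hck] at hpos hmin
  have hci : c i ≠ 0 := Int.natAbs_pos.1 hpos
  have hδi : (δ i : ℝ) ≠ 0 := by exact_mod_cast hi
  have hcoord : (c i : ℝ) = t * δ i := congrFun hct i
  have ht : t ≠ 0 := by
    rintro rfl
    rw [zero_mul] at hcoord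
    exact hci (by exact_mod_cast hcoord)
  refine ⟨c, fun h => hci (congrFun h i), ⟨t⁻¹, by rw [hct, smul_smul, inv_mul_cancel₀ ht,
    one_smul]⟩, ?_⟩
  rintro v ⟨s, hv⟩
  refine ⟨v i / c i, ?_⟩
  -- the remainder of the division lies on the line, so that it vanishes by minimality
  set q := v i / c i
  have hrem : realVec (v - q • c) = ((s - q) * t) • realVec δ := by
    have h1 : realVec (v - q • c) = realVec v - (q : ℝ) • realVec c := by
      funext j; simp [realVec]
    rw [h1, hv, hct, smul_smul, smul_smul, ← sub_smul, ← sub_mul]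
  have hi0 : (v - q • c) i = v i % c i := by
    simp only [Pi.sub_apply, Pi.smul_apply, smul_eq_mul, q]
    rw [Int.emod_def, mul_comm]
  have hzero : (v - q • c) i = 0 := by
    by_contra hne
    refine hmin ((v - q • c) i).natAbs ?_ ⟨Int.natAbs_pos.2 hne, _, rfl, _, hrem⟩
    rw [hi0]
    have h1 := Int.emod_nonneg (v i) hci
    have h2 := Int.emod_lt_abs (v i) hci
    rcases abs_cases (c i) with ⟨h, -⟩ | ⟨h, -⟩ <;> rw [h] at h2 <;> omega
  have h2 : (s - q) * t = 0 := by
    have h3 : ((v - q • c) i : ℝ) = (s - q) * t * δ i := congrFun hrem i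
    rw [hzero, Int.cast_zero] at h3
    exact (mul_eq_zero.1 h3.symm).resolve_right hδi
  rw [h2, zero_smul] at hrem
  funext j
  have h3 : ((v - q • c) j : ℝ) = 0 := congrFun hrem j
  have h4 : (v - q • c) j = 0 := by exact_mod_cast h3
  rw [Pi.sub_apply] at h4
  exact sub_eq_zero.1 h4

/-- A vector on which all nonnegative forms vanishing on `c` are nonnegative dominates a
multiple of `c`. -/
lemma exists_smul_le {c v : Fin n → ℝ} (hc : ∃ i, 0 < c i)
    (h : ∀ w : Fin n → ℝ, 0 ≤ w → w ⬝ᵥ c = 0 → 0 ≤ w ⬝ᵥ v) : ∃ t : ℝ, t • c ≤ v := by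
  classical
  obtain ⟨i₀, hi₀⟩ := hc
  obtain ⟨i, hi, hmin⟩ := Finset.exists_min_image (Finset.univ.filter fun i => 0 < c i)
    (fun i => v i / c i) ⟨i₀, by simpa using hi₀⟩
  have hi : 0 < c i := by simpa using hi
  refine ⟨v i / c i, fun j => ?_⟩
  rw [Pi.smul_apply, smul_eq_mul]
  rcases lt_trichotomy (c j) 0 with hj | hj | hj
  · have h1 := h (Pi.single i (-c j) + Pi.single j (c i))
      (add_nonneg (Pi.single_nonneg.2 (by linarith)) (Pi.single_nonneg.2 hi.le)) (by
        rw [add_dotProduct, single_dotProduct, single_dotProduct]; ring)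
    rw [add_dotProduct, single_dotProduct, single_dotProduct] at h1
    rw [div_mul_eq_mul_div, div_le_iff₀ hi]
    linarith
  · rw [hj, mul_zero]
    have h1 := h (Pi.single j 1) (Pi.single_nonneg.2 zero_le_one) (by
      rw [single_dotProduct, hj, mul_zero])
    rwa [single_dotProduct, one_mul] at h1
  · have h1 := hmin j (by simpa using hj)
    rwa [le_div_iff₀ hj] at h1

lemma exists_pos_of_dotProduct_eq_zero {c ξ : Fin n → ℝ} (hξ : ∀ i, 0 < ξ i) (hc : c ≠ 0)
    (h : ξ ⬝ᵥ c = 0) : ∃ i, 0 < c i := by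
  by_contra! hcon
  have h1 := dotProduct_pos_of_pos (v := -c) hξ (fun i => by simpa using hcon i)
    (neg_ne_zero.2 hc)
  rw [dotProduct_neg, h] at h1
  simp at h1

variable {R : Type*} [CommRing R]

/-- A form `ξ₁ > 0` that is constant on a loose edge attains its minimum on the edge. Otherwise
move from the form `ξ` defining the edge towards `ξ₁`; the first form at which another exponent
reaches the minimum defines a compact face of dimension at least two containing the edge. -/
lemma dotProduct_le_of_isLooseEdge {b : MvPolynomial (Fin n) R} {E : Set (Fin n → ℝ)}
    (hE : IsLooseEdge (newtonPolyhedron b) E) {ξ : Fin n → ℝ} {m : ℝ} (hξ : ∀ i, 0 < ξ i)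
    (hm : ∀ α, b.coeff α ≠ 0 → m ≤ ξ ⬝ᵥ toPoint α)
    (hEm : E = convexHull ℝ (toPoint '' {α | b.coeff α ≠ 0 ∧ ξ ⬝ᵥ toPoint α = m}))
    {α₀ : Fin n →₀ ℕ} (hα₀ : b.coeff α₀ ≠ 0) (hα₀m : ξ ⬝ᵥ toPoint α₀ = m)
    {ξ₁ : Fin n → ℝ} (hξ₁ : ∀ i, 0 < ξ₁ i)
    (hconst : ∀ α, b.coeff α ≠ 0 → ξ ⬝ᵥ toPoint α = m → ξ₁ ⬝ᵥ toPoint α = ξ₁ ⬝ᵥ toPoint α₀)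
    {α : Fin n →₀ ℕ} (hα : b.coeff α ≠ 0) : ξ₁ ⬝ᵥ toPoint α₀ ≤ ξ₁ ⬝ᵥ toPoint α := by
  classical
  by_contra! hlt
  let φ : (Fin n →₀ ℕ) → ℝ := fun β => ξ ⬝ᵥ toPoint β - m
  let ψ : (Fin n →₀ ℕ) → ℝ := fun β => ξ₁ ⬝ᵥ toPoint β - ξ₁ ⬝ᵥ toPoint α₀
  have hφψ : ∀ β, b.coeff β ≠ 0 → ψ β < 0 → 0 < φ β := by
    intro β hβ hψ
    refine lt_of_le_of_ne (sub_nonneg.2 (hm β hβ)) fun h0 => ?_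
    have h1 := hconst β hβ (sub_eq_zero.1 h0.symm)
    simp only [ψ, h1, sub_self, lt_irrefl] at hψ
  obtain ⟨β, hβ, hβmin⟩ := Finset.exists_min_image (b.support.filter fun β => ψ β < 0)
    (fun β => φ β / (φ β - ψ β)) ⟨α, by
      rw [Finset.mem_filter]; exact ⟨mem_support_iff.2 hα, sub_neg.2 hlt⟩⟩
  rw [Finset.mem_filter, mem_support_iff] at hβ
  obtain ⟨hβ, hψβ⟩ := hβ
  have hφβ := hφψ β hβ hψβ
  set s := φ β / (φ β - ψ β) with hs
  have hs0 : 0 < s := div_pos hφβ (by linarith)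
  have hs1 : s < 1 := (div_lt_one (by linarith)).2 (by linarith)
  let η : Fin n → ℝ := (1 - s) • ξ + s • ξ₁
  have hη : ∀ i, 0 < η i := fun i => by
    have h1 := mul_pos (sub_pos.2 hs1) (hξ i)
    have h2 := mul_pos hs0 (hξ₁ i)
    simpa [η] using add_pos h1 h2
  have hηφ : ∀ γ, η ⬝ᵥ toPoint γ = (1 - s) * φ γ + s * ψ γ + η ⬝ᵥ toPoint α₀ := by
    intro γ
    simp only [η, add_dotProduct, smul_dotProduct, smul_eq_mul, φ, ψ, hα₀m]
    ring
  have hηm : ∀ γ, b.coeff γ ≠ 0 → η ⬝ᵥ toPoint α₀ ≤ η ⬝ᵥ toPoint γ := by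
    intro γ hγ
    rw [hηφ γ]
    have hφγ : 0 ≤ φ γ := sub_nonneg.2 (hm γ hγ)
    suffices 0 ≤ (1 - s) * φ γ + s * ψ γ by linarith
    by_cases hψγ : ψ γ < 0
    · have h1 := hβmin γ (Finset.mem_filter.2 ⟨mem_support_iff.2 hγ, hψγ⟩)
      have h2 := hφψ γ hγ hψγ
      rw [le_div_iff₀ (by linarith)] at h1
      linarith
    · have h1 := mul_nonneg (sub_pos.2 hs1).le hφγ
      have h2 := mul_nonneg hs0.le (not_lt.1 hψγ)
      linarith
  have hηβ : η ⬝ᵥ toPoint β = η ⬝ᵥ toPoint α₀ := by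
    have h1 : s * (φ β - ψ β) = φ β := div_mul_cancel₀ _ (by linarith)
    rw [hηφ β]
    linarith
  set F := convexHull ℝ (toPoint '' {γ | b.coeff γ ≠ 0 ∧ η ⬝ᵥ toPoint γ = η ⬝ᵥ toPoint α₀})
    with hF
  have hFc : IsCompactFace (newtonPolyhedron b) F := isCompactFace_of_pos hη hηm ⟨α₀, hα₀, rfl⟩
  have hEF : E ⊆ F := by
    rw [hEm, hF]
    refine convexHull_mono (Set.image_mono fun γ hγ => ⟨hγ.1, ?_⟩)
    rw [hηφ γ]
    simp only [φ, ψ, hγ.2, hconst γ hγ.1 hγ.2]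
    ring
  refine hE.2.2 F hFc hEF ?_
  have hβF : toPoint β ∈ F := subset_convexHull _ _ ⟨β, ⟨hβ, hηβ⟩, rfl⟩
  have hαF : toPoint α₀ ∈ F := subset_convexHull _ _ ⟨α₀, ⟨hα₀, rfl⟩, rfl⟩
  -- the form `ξ` vanishes on the direction of the edge but not on `β - α₀`
  have hker : vectorSpan ℝ E ≤ LinearMap.ker (isLinearMap_dotProduct ξ).mk' := by
    rw [vectorSpan_def, Submodule.span_le]
    rintro _ ⟨p, hp, q, hq, rfl⟩
    have hface : ∀ p ∈ E, ξ ⬝ᵥ p = m := by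
      intro p hp
      rw [hEm] at hp
      refine convexHull_min ?_ (convex_hyperplane (isLinearMap_dotProduct ξ) m) hp
      rintro _ ⟨γ, hγ, rfl⟩
      exact hγ.2
    simp [dotProduct_sub, hface p hp, hface q hq]
  have hlt' : vectorSpan ℝ E < vectorSpan ℝ F := by
    refine lt_of_le_of_ne (vectorSpan_mono ℝ hEF) fun heq => ?_
    have h1 : toPoint β - toPoint α₀ ∈ vectorSpan ℝ E := by
      rw [heq]; exact vsub_mem_vectorSpan ℝ hβF hαF
    have h2 : ξ ⬝ᵥ (toPoint β - toPoint α₀) = 0 := hker h1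
    rw [dotProduct_sub, hα₀m] at h2
    exact hφβ.ne' h2
  have h3 := Submodule.finrank_lt_finrank_of_lt hlt'
  have h4 : Module.finrank ℝ (vectorSpan ℝ E) = 1 := hE.2.1
  unfold faceDim
  omega

/-- The shape of a loose edge `E`: it has an integral direction `c`, and every exponent lies in
`E + ℝ c + ℝ_{≥0}ⁿ`. -/
theorem IsLooseEdge.exists_direction {b : MvPolynomial (Fin n) R} {E : Set (Fin n → ℝ)}
    (hE : IsLooseEdge (newtonPolyhedron b) E) :
    ∃ (ξ : Fin n → ℝ) (m : ℝ) (α₀ : Fin n →₀ ℕ) (c : Fin n → ℤ),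
      (∀ i, 0 < ξ i) ∧ (∀ α, b.coeff α ≠ 0 → m ≤ ξ ⬝ᵥ toPoint α) ∧
      b.coeff α₀ ≠ 0 ∧ ξ ⬝ᵥ toPoint α₀ = m ∧
      E = convexHull ℝ (toPoint '' {α | b.coeff α ≠ 0 ∧ ξ ⬝ᵥ toPoint α = m}) ∧
      c ≠ 0 ∧ ξ ⬝ᵥ realVec c = 0 ∧
      (∀ v : Fin n → ℤ, (∃ t : ℝ, realVec v = t • realVec c) → ∃ k : ℤ, v = k • c) ∧
      (∀ α, b.coeff α ≠ 0 → ξ ⬝ᵥ toPoint α = m → ∃ k : ℤ, ∀ i, (α i : ℤ) = α₀ i + k * c i) ∧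
      (∀ α, b.coeff α ≠ 0 → ∃ t : ℝ, toPoint α₀ + t • realVec c ≤ toPoint α) := by
  classical
  obtain ⟨⟨⟨ξ, hξ0, hEξ⟩, hc⟩, hdim, -⟩ := id hE
  have hne : E.Nonempty := by
    by_contra h
    rw [Set.not_nonempty_iff_eq_empty] at h
    rw [h, faceDim, vectorSpan_empty, finrank_bot] at hdim
    exact zero_ne_one hdim
  have hξ : ∀ i, 0 < ξ i := pos_of_isCompact_faceOf hξ0 (hEξ ▸ hc) (hEξ ▸ hne)
  have hsupp : b.support.Nonempty := by
    obtain ⟨p, hp⟩ := hne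
    rw [hEξ] at hp
    have h1 := hp.1
    rw [newtonPolyhedron_eq] at h1
    obtain ⟨u, hu, -⟩ := h1
    obtain ⟨_, α, hα, rfl⟩ := convexHull_nonempty_iff.1 ⟨u, hu⟩
    exact ⟨α, mem_support_iff.2 hα⟩
  obtain ⟨α₀, hα₀, hα₀min⟩ := Finset.exists_min_image b.support (fun α => ξ ⬝ᵥ toPoint α) hsupp
  rw [mem_support_iff] at hα₀
  have hm : ∀ α, b.coeff α ≠ 0 → ξ ⬝ᵥ toPoint α₀ ≤ ξ ⬝ᵥ toPoint α := fun α hα =>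
    hα₀min α (mem_support_iff.2 hα)
  have hEm := hEξ
  rw [faceOf_newtonPolyhedron hξ hm ⟨α₀, hα₀, rfl⟩] at hEm
  set BE := {α | b.coeff α ≠ 0 ∧ ξ ⬝ᵥ toPoint α = ξ ⬝ᵥ toPoint α₀} with hBE
  have hmem : ∀ α ∈ BE, toPoint α ∈ E := fun α hα => by
    rw [hEm]; exact subset_convexHull _ _ ⟨α, hα, rfl⟩
  have hα₀E : α₀ ∈ BE := ⟨hα₀, rfl⟩
  obtain ⟨α₁, hα₁, hne₁⟩ : ∃ α₁ ∈ BE, α₁ ≠ α₀ := by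
    by_contra! hcon
    have h1 : BE = {α₀} := Set.eq_singleton_iff_unique_mem.2 ⟨hα₀E, hcon⟩
    rw [hEm, h1, Set.image_singleton, convexHull_singleton, faceDim, vectorSpan_singleton,
      finrank_bot] at hdim
    exact zero_ne_one hdim
  let δ : Fin n → ℤ := fun i => (α₁ i : ℤ) - α₀ i
  have hδreal : realVec δ = toPoint α₁ - toPoint α₀ := by funext i; simp [realVec, δ, toPoint]
  have hδ : δ ≠ 0 := by
    intro h
    apply hne₁
    ext i
    have h1 : (α₁ i : ℤ) - α₀ i = 0 := congrFun h i
    omega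
  have hδreal0 : realVec δ ≠ 0 := by
    rw [hδreal, sub_ne_zero]; exact fun h => hne₁ (toPoint_injective h)
  obtain ⟨c, hc0, ⟨s, hs⟩, hprim⟩ := exists_primitive hδ
  have hline : ∀ α ∈ BE, ∃ t : ℝ, toPoint α - toPoint α₀ = t • realVec c := by
    intro α hα
    have h1 : toPoint α - toPoint α₀ ∈ vectorSpan ℝ E :=
      vsub_mem_vectorSpan ℝ (hmem α hα) (hmem α₀ hα₀E)
    have h2 : realVec δ ∈ vectorSpan ℝ E := by
      rw [hδreal]; exact vsub_mem_vectorSpan ℝ (hmem α₁ hα₁) (hmem α₀ hα₀E)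
    obtain ⟨t, ht⟩ := (finrank_eq_one_iff_of_nonzero' (⟨realVec δ, h2⟩ : vectorSpan ℝ E)
      (fun h => hδreal0 (congrArg Subtype.val h))).1 hdim ⟨_, h1⟩
    have h3 : t • realVec δ = toPoint α - toPoint α₀ := congrArg Subtype.val ht
    exact ⟨t * s, by rw [← h3, hs, smul_smul]⟩
  have hs0 : s ≠ 0 := by rintro rfl; rw [zero_smul] at hs; exact hδreal0 hs
  have hξc : ξ ⬝ᵥ realVec c = 0 := by
    have h1 : ξ ⬝ᵥ realVec δ = 0 := by rw [hδreal, dotProduct_sub, hα₁.2, sub_self]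
    rw [hs, dotProduct_smul, smul_eq_mul] at h1
    exact (mul_eq_zero.1 h1).resolve_left hs0
  have hcreal : realVec c ≠ 0 := by
    intro h; rw [h, smul_zero] at hs; exact hδreal0 hs
  refine ⟨ξ, _, α₀, c, hξ, hm, hα₀, rfl, hEm, hc0, hξc, hprim, fun α hα hαm => ?_,
    fun α hα => ?_⟩
  · obtain ⟨t, ht⟩ := hline α ⟨hα, hαm⟩
    obtain ⟨k, hk⟩ := hprim (fun i => (α i : ℤ) - α₀ i) ⟨t, by
      rw [← ht]; funext i; simp [realVec, toPoint]⟩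
    refine ⟨k, fun i => ?_⟩
    have h1 : (α i : ℤ) - α₀ i = k * c i := congrFun hk i
    omega
  · obtain ⟨t, ht⟩ := exists_smul_le (v := toPoint α - toPoint α₀)
      (exists_pos_of_dotProduct_eq_zero hξ hcreal hξc) (fun w hw hwc => by
        -- perturb `w` to a positive form
        have hpert : ∀ ε : ℝ, 0 < ε →
            0 ≤ w ⬝ᵥ (toPoint α - toPoint α₀) + ε * (ξ ⬝ᵥ (toPoint α - toPoint α₀)) := by
          intro ε hε
          have h1 := dotProduct_le_of_isLooseEdge hE hξ hm hEm hα₀ rfl (ξ₁ := w + ε • ξ)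
            (fun i => add_pos_of_nonneg_of_pos (hw i) (mul_pos hε (hξ i)))
            (fun β hβ hβm => by
              obtain ⟨t, ht⟩ := hline β ⟨hβ, hβm⟩
              rw [← sub_eq_zero, ← dotProduct_sub, ht, dotProduct_smul, add_dotProduct,
                smul_dotProduct, hwc, hξc, smul_zero, add_zero, smul_zero]) hα
          rw [← sub_nonneg, ← dotProduct_sub, add_dotProduct, smul_dotProduct, smul_eq_mul] at h1
          exact h1
        have h0 : 0 ≤ ξ ⬝ᵥ (toPoint α - toPoint α₀) := by
          rw [dotProduct_sub, sub_nonneg]; exact hm α hα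
        by_contra! hneg
        have hD : 0 < ξ ⬝ᵥ (toPoint α - toPoint α₀) + 1 := by linarith
        have h1 := hpert (-(w ⬝ᵥ (toPoint α - toPoint α₀)) /
          (ξ ⬝ᵥ (toPoint α - toPoint α₀) + 1)) (div_pos (by linarith) hD)
        have h2 : w ⬝ᵥ (toPoint α - toPoint α₀) + -(w ⬝ᵥ (toPoint α - toPoint α₀)) /
            (ξ ⬝ᵥ (toPoint α - toPoint α₀) + 1) * (ξ ⬝ᵥ (toPoint α - toPoint α₀)) =
            w ⬝ᵥ (toPoint α - toPoint α₀) / (ξ ⬝ᵥ (toPoint α - toPoint α₀) + 1) := by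
          field_simp
          ring
        rw [h2] at h1
        exact absurd h1 (not_le.2 (div_neg_of_neg_of_pos hneg hD)))
    refine ⟨t, ?_⟩
    rw [add_comm]
    exact le_sub_iff_add_le.1 ht

end LooseEdge

/-! ### Polynomials supported on a line -/

section Line

open MvPolynomial

variable {n : ℕ} {K : Type*} [Field K]

/-- The exponents on the line `μ + ℤ c`. -/
def lineSet (c μ : Fin n → ℤ) : Set (Fin n →₀ ℕ) := {γ | ∃ k : ℤ, ∀ i, (γ i : ℤ) = μ i + k * c i}

/-- An exponent vector as an integral vector. -/
def intVec (α : Fin n →₀ ℕ) : Fin n → ℤ := fun i => (α i : ℤ)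

lemma self_mem_lineSet (c : Fin n → ℤ) (α : Fin n →₀ ℕ) : α ∈ lineSet c (intVec α) :=
  ⟨0, fun i => by simp [intVec]⟩

/-- A factor of a polynomial that is homogeneous for the weight `w` is homogeneous. The proof
substitutes `Xᵢ T^(wᵢ)` for `Xᵢ` and compares the lowest and the highest power of `T`. -/
lemma weight_eq_of_mul {P Q : MvPolynomial (Fin n) K} (hPQ : P * Q ≠ 0) {w : Fin n → ℕ} {N : ℕ}
    (hw : ∀ γ ∈ (P * Q).support, ∑ i, γ i * w i = N) :
    ∃ M, ∀ α ∈ P.support, ∑ i, α i * w i = M := by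
  classical
  let ψ : MvPolynomial (Fin n) K →ₐ[K] Polynomial (MvPolynomial (Fin n) K) :=
    aeval fun i => Polynomial.C (X i) * Polynomial.X ^ w i
  have hmon : ∀ (α : Fin n →₀ ℕ) (a : K), ψ (monomial α a) =
      Polynomial.monomial (∑ i, α i * w i) (monomial α a) := by
    intro α a
    simp only [ψ]
    rw [aeval_monomial, Finsupp.prod_fintype _ _ (by simp)]
    simp only [mul_pow, Finset.prod_mul_distrib, ← pow_mul, ← map_pow, ← map_prod]
    have h1 : algebraMap K (Polynomial (MvPolynomial (Fin n) K)) a = Polynomial.C (C a) := rfl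
    have h2 : ∏ i, (Polynomial.X : Polynomial (MvPolynomial (Fin n) K)) ^ (w i * α i) =
        Polynomial.X ^ ∑ i, α i * w i := by
      rw [Finset.prod_pow_eq_pow_sum]
      simp only [mul_comm]
    rw [h2, h1, ← mul_assoc, ← map_mul, Polynomial.C_mul_X_pow_eq_monomial,
      monomial_eq, Finsupp.prod_fintype _ _ (by simp)]
  have hψ : ∀ F : MvPolynomial (Fin n) K,
      ψ F = ∑ α ∈ F.support, Polynomial.monomial (∑ i, α i * w i) (monomial α (F.coeff α)) := by
    intro F
    conv_lhs => rw [F.as_sum]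
    rw [map_sum]
    simp only [hmon]
  have hcoeff : ∀ (F : MvPolynomial (Fin n) K), ∀ α ∈ F.support,
      (ψ F).coeff (∑ i, α i * w i) ≠ 0 := by
    intro F α hα h0
    have h1 := congrArg (coeff α) h0
    rw [hψ, Polynomial.finsetSum_coeff, coeff_sum, coeff_zero,
      Finset.sum_eq_single α] at h1
    · rw [Polynomial.coeff_monomial, if_pos rfl, coeff_monomial, if_pos rfl] at h1
      exact mem_support_iff.1 hα h1
    · intro β _ hβ
      rw [Polynomial.coeff_monomial]
      split_ifs
      · rw [coeff_monomial, if_neg hβ]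
      · rw [coeff_zero]
    · intro h; exact absurd hα h
  have hne : ∀ F : MvPolynomial (Fin n) K, F ≠ 0 → ψ F ≠ 0 := by
    intro F hF h0
    obtain ⟨α, hα⟩ := support_nonempty.2 hF
    refine hcoeff F α hα ?_
    rw [h0, Polynomial.coeff_zero]
  have hP := left_ne_zero_of_mul hPQ
  have hQ := right_ne_zero_of_mul hPQ
  have hprod : ψ P * ψ Q = Polynomial.monomial N (P * Q) := by
    rw [← map_mul, hψ, Finset.sum_congr rfl fun α hα => by rw [hw α hα], ← map_sum, ← as_sum]
  have h1 := Polynomial.natDegree_mul (hne P hP) (hne Q hQ)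
  have h2 := Polynomial.natTrailingDegree_mul (hne P hP) (hne Q hQ)
  rw [hprod, Polynomial.natDegree_monomial_eq _ hPQ] at h1
  rw [hprod, Polynomial.natTrailingDegree_monomial hPQ] at h2
  have h3 := Polynomial.natTrailingDegree_le_natDegree (ψ P)
  have h4 := Polynomial.natTrailingDegree_le_natDegree (ψ Q)
  refine ⟨(ψ P).natDegree, fun α hα => ?_⟩
  have h5 := Polynomial.le_natDegree_of_ne_zero (hcoeff P α hα)
  have h6 := Polynomial.natTrailingDegree_le_of_ne_zero (hcoeff P α hα)
  omega

/-- An integral vector annihilated by all weights that annihilate `c` is a multiple of `c`. -/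
lemma exists_eq_smul_of_weights {c : Fin n → ℤ}
    (hprim : ∀ v : Fin n → ℤ, (∃ t : ℝ, realVec v = t • realVec c) → ∃ k : ℤ, v = k • c)
    {i₀ j₀ : Fin n} (hi₀ : 0 < c i₀) (hj₀ : c j₀ < 0) {v : Fin n → ℤ}
    (h : ∀ w : Fin n → ℕ, ∑ i, (w i : ℤ) * c i = 0 → ∑ i, (w i : ℤ) * v i = 0) :
    ∃ k : ℤ, v = k • c := by
  classical
  have hpair : ∀ i j, 0 < c i → c j < 0 → c i * v j = c j * v i := by
    intro i j hi hj
    have hsum : ∀ u : Fin n → ℤ, ∑ k, (((Pi.single i (c j).natAbs + Pi.single j (c i).natAbs :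
        Fin n → ℕ) k : ℕ) : ℤ) * u k = -c j * u i + c i * u j := by
      intro u
      simp only [Pi.add_apply, Nat.cast_add, add_mul, Finset.sum_add_distrib]
      rw [Finset.sum_eq_single i, Finset.sum_eq_single j]
      · simp only [Pi.single_eq_same, Int.natCast_natAbs, abs_of_pos hi, abs_of_neg hj]
      · intro k _ hk; simp [hk]
      · simp
      · intro k _ hk; simp [hk]
      · simp
    have h1 := h (Pi.single i (c j).natAbs + Pi.single j (c i).natAbs) (by rw [hsum]; ring)
    rw [hsum] at h1
    linarith
  have hzero : ∀ k, c k = 0 → v k = 0 := by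
    intro k hk
    have hsum : ∀ u : Fin n → ℤ, ∑ i, (((Pi.single k 1 : Fin n → ℕ) i : ℕ) : ℤ) * u i = u k := by
      intro u
      rw [Finset.sum_eq_single k]
      · simp
      · intro i _ hi; simp [hi]
      · simp
    have h1 := h (Pi.single k 1) (by rw [hsum, hk])
    rwa [hsum] at h1
  refine hprim v ⟨(v i₀ : ℝ) / c i₀, ?_⟩
  have hci₀ : (c i₀ : ℝ) ≠ 0 := by exact_mod_cast hi₀.ne'
  have hneg : ∀ j, c j < 0 → (v j : ℝ) = v i₀ / c i₀ * c j := by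
    intro j hj
    have h1 : (c i₀ : ℝ) * v j = c j * v i₀ := by exact_mod_cast hpair i₀ j hi₀ hj
    field_simp
    linarith
  funext j
  simp only [realVec, Pi.smul_apply, smul_eq_mul]
  rcases lt_trichotomy (c j) 0 with hj | hj | hj
  · exact hneg j hj
  · rw [hj, hzero j hj]; simp
  · have h1 : (c j : ℝ) * v j₀ = c j₀ * v j := by exact_mod_cast hpair j j₀ hj hj₀
    have hcj₀ : (c j₀ : ℝ) ≠ 0 := by exact_mod_cast hj₀.ne
    rw [hneg j₀ hj₀] at h1
    apply mul_left_cancel₀ hcj₀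
    rw [← h1]
    ring

variable {c : Fin n → ℤ}

/-- A factor of a polynomial supported on a line is supported on a parallel line. -/
lemma support_subset_lineSet_of_mul
    (hprim : ∀ v : Fin n → ℤ, (∃ t : ℝ, realVec v = t • realVec c) → ∃ k : ℤ, v = k • c)
    {i₀ j₀ : Fin n} (hi₀ : 0 < c i₀) (hj₀ : c j₀ < 0) {P Q : MvPolynomial (Fin n) K}
    (hPQ : P * Q ≠ 0) {μ : Fin n → ℤ} (h : ∀ γ ∈ (P * Q).support, γ ∈ lineSet c μ)
    {β : Fin n →₀ ℕ} (hβ : β ∈ P.support) : ∀ α ∈ P.support, α ∈ lineSet c (intVec β) := by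
  intro α hα
  obtain ⟨k, hk⟩ := exists_eq_smul_of_weights hprim hi₀ hj₀
    (v := intVec α - intVec β) (fun w hw => by
      obtain ⟨γ₀, hγ₀⟩ := support_nonempty.2 hPQ
      have hconst : ∀ γ ∈ (P * Q).support, ∑ i, (γ i : ℤ) * w i = ∑ i, μ i * w i := by
        intro γ hγ
        obtain ⟨k, hk⟩ := h γ hγ
        simp only [hk, add_mul, Finset.sum_add_distrib]
        have : ∑ i, k * c i * (w i : ℤ) = k * ∑ i, (w i : ℤ) * c i := by
          rw [Finset.mul_sum]
          exact Finset.sum_congr rfl fun i _ => by ring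
        rw [this, hw, mul_zero, add_zero]
      obtain ⟨M, hM⟩ := weight_eq_of_mul hPQ (w := w) (N := ∑ i, γ₀ i * w i) (fun γ hγ => by
        have := (hconst γ hγ).trans (hconst γ₀ hγ₀).symm
        exact_mod_cast this)
      have h1 : ∑ i, (α i : ℤ) * w i = ∑ i, (β i : ℤ) * w i := by
        exact_mod_cast (hM α hα).trans (hM β hβ).symm
      simp only [intVec, Pi.sub_apply, mul_sub, Finset.sum_sub_distrib]
      rw [sub_eq_zero]
      simpa only [mul_comm] using h1)
  refine ⟨k, fun i => ?_⟩
  have h1 : (α i : ℤ) - β i = k * c i := congrFun hk i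
  simp only [intVec]
  omega

/-- The support of a nonzero polynomial on a line has two end points `p₀` and `p₀ + d c`. -/
lemma exists_endpoints {i₀ : Fin n} (hi₀ : 0 < c i₀) {P : MvPolynomial (Fin n) K} (hP : P ≠ 0)
    (h : ∀ β ∈ P.support, ∀ α ∈ P.support, α ∈ lineSet c (intVec β)) :
    ∃ p₀ ∈ P.support, ∃ p₁ ∈ P.support, ∃ d : ℕ, (∀ i, (p₁ i : ℤ) = p₀ i + d * c i) ∧
      ∀ α ∈ P.support, ∃ k : ℕ, k ≤ d ∧ ∀ i, (α i : ℤ) = p₀ i + k * c i := by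
  obtain ⟨p₀, hp₀, hmin⟩ := Finset.exists_min_image P.support (fun α => α i₀)
    (support_nonempty.2 hP)
  obtain ⟨p₁, hp₁, hmax⟩ := Finset.exists_max_image P.support (fun α => α i₀)
    (support_nonempty.2 hP)
  have hk : ∀ α ∈ P.support, ∃ k : ℕ, ∀ i, (α i : ℤ) = p₀ i + k * c i := by
    intro α hα
    obtain ⟨k, hk⟩ := h p₀ hp₀ α hα
    have h1 := hk i₀
    have h2 : (p₀ i₀ : ℤ) ≤ α i₀ := by exact_mod_cast hmin α hα
    have h3 : 0 ≤ k := by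
      simp only [intVec] at h1
      by_contra hneg
      have := mul_neg_of_neg_of_pos (not_le.1 hneg) hi₀
      omega
    lift k to ℕ using h3
    exact ⟨k, hk⟩
  obtain ⟨d, hd⟩ := hk p₁ hp₁
  refine ⟨p₀, hp₀, p₁, hp₁, d, hd, fun α hα => ?_⟩
  obtain ⟨k, hk⟩ := hk α hα
  refine ⟨k, ?_, hk⟩
  have h1 : (α i₀ : ℤ) ≤ p₁ i₀ := by exact_mod_cast hmax α hα
  rw [hk, hd] at h1
  have h2 : (k : ℤ) * c i₀ ≤ d * c i₀ := by linarith
  exact_mod_cast le_of_mul_le_mul_right h2 hi₀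

/-- If no variable divides `G`, its lower end point is `d c⁻`. -/
lemma endpoint_eq_of_not_dvd {G : MvPolynomial (Fin n) K} (hG : ∀ i, ¬ X i ∣ G)
    {p₀ p₁ : Fin n →₀ ℕ} {d : ℕ}
    (hd : ∀ i, (p₁ i : ℤ) = p₀ i + d * c i)
    (h : ∀ α ∈ G.support, ∃ k : ℕ, k ≤ d ∧ ∀ i, (α i : ℤ) = p₀ i + k * c i) (i : Fin n) :
    (p₀ i : ℤ) = d * max 0 (-c i) := by
  obtain ⟨α, hα, hαi⟩ : ∃ α ∈ G.support, α i = 0 := by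
    by_contra! hcon
    apply hG i
    rw [G.as_sum]
    exact Finset.dvd_sum fun α hα => X_dvd_monomial.2 (Or.inr (hcon α hα))
  obtain ⟨k, hkd, hk⟩ := h α hα
  have h1 := hk i
  rw [hαi, Nat.cast_zero] at h1
  have hkd' : (k : ℤ) ≤ d := by exact_mod_cast hkd
  rcases le_total 0 (c i) with hc | hc
  · rw [max_eq_left (by linarith), mul_zero]
    have : 0 ≤ (k : ℤ) * c i := mul_nonneg (by positivity) hc
    have : (0 : ℤ) ≤ p₀ i := by positivity
    omega
  · rw [max_eq_right (by linarith)]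
    have h2 := hd i
    have h3 : (d : ℤ) * c i ≤ k * c i := mul_le_mul_of_nonpos_right hkd' hc
    have : (0 : ℤ) ≤ p₁ i := by positivity
    linarith

/-- The extreme exponents of a product of polynomials supported on parallel lines. -/
lemma coeff_mul_of_extreme {P Q : MvPolynomial (Fin n) K} {p q : Fin n →₀ ℕ}
    (h : ∀ α ∈ P.support, ∀ β ∈ Q.support, α + β = p + q → α = p ∧ β = q) :
    (P * Q).coeff (p + q) = P.coeff p * Q.coeff q := by
  classical
  rw [coeff_mul]
  refine Finset.sum_eq_single (p, q) ?_ ?_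
  · rintro ⟨α, β⟩ hαβ hne
    rw [Finset.HasAntidiagonal.mem_antidiagonal] at hαβ
    by_contra hne0
    obtain ⟨h1, h2⟩ := h α (mem_support_iff.2 (left_ne_zero_of_mul hne0)) β
      (mem_support_iff.2 (right_ne_zero_of_mul hne0)) hαβ
    exact hne (by rw [h1, h2])
  · intro hne
    exact absurd (Finset.HasAntidiagonal.mem_antidiagonal.2 (rfl : (p, q).1 + (p, q).2 = p + q)) hne

/-! ### Counting the exponents on a line -/

/-- The integers `k` with `μ + k c ≥ 0`. -/
def lineParam (c μ : Fin n → ℤ) : Set ℤ := {k | ∀ i, 0 ≤ μ i + k * c i}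

lemma finite_lineParam {i₀ j₀ : Fin n} (hi₀ : 0 < c i₀) (hj₀ : c j₀ < 0) (μ : Fin n → ℤ) :
    (lineParam c μ).Finite := by
  refine (Set.finite_Icc (-|μ i₀|) |μ j₀|).subset fun k hk => ⟨?_, ?_⟩
  · have h1 := hk i₀
    have h2 := le_abs_self (μ i₀)
    by_contra! hlt
    have h3 := abs_nonneg (μ i₀)
    nlinarith
  · have h1 := hk j₀
    have h2 := le_abs_self (μ j₀)
    by_contra! hlt
    have h3 := abs_nonneg (μ j₀)
    nlinarith

lemma ordConnected_lineParam (μ : Fin n → ℤ) : (lineParam c μ).OrdConnected := by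
  refine ⟨fun a ha b hb k hk i => ?_⟩
  have h1 := ha i
  have h2 := hb i
  rcases le_total 0 (c i) with hc | hc
  · have := mul_le_mul_of_nonneg_right hk.1 hc
    linarith
  · have := mul_le_mul_of_nonpos_right hk.2 hc
    linarith

lemma lineParam_sub {μ : Fin n → ℤ} {d : ℕ} :
    lineParam c (fun i => μ i - d * max 0 (-c i)) =
      {k ∈ lineParam c μ | k + d ∈ lineParam c μ} := by
  have hd : (0 : ℤ) ≤ d := by positivity
  ext k
  constructor
  · intro h
    refine ⟨fun i => ?_, fun i => ?_⟩
    · have h1 := h i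
      have := mul_nonneg hd (le_max_left 0 (-c i))
      linarith
    · have h1 := h i
      have := mul_le_mul_of_nonneg_left (le_max_right 0 (-c i)) hd
      have h2 : (k + d) * c i = k * c i - d * (-c i) := by ring
      rw [h2]
      linarith
  · rintro ⟨h1, h2⟩ i
    have h3 := h1 i
    have h4 := h2 i
    change 0 ≤ μ i - d * max 0 (-c i) + k * c i
    rcases le_total 0 (-c i) with hc | hc
    · rw [max_eq_right hc]; linarith
    · rw [max_eq_left hc]; linarith

/-- The exponents on a line correspond to the parameters. -/
lemma ncard_lineSet (hc : c ≠ 0) (μ : Fin n → ℤ) :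
    (lineSet c μ).ncard = (lineParam c μ).ncard := by
  symm
  obtain ⟨i, hi⟩ := Function.ne_iff.1 hc
  have hi : c i ≠ 0 := hi
  refine Set.ncard_congr (fun k _ => Finsupp.equivFunOnFinite.symm fun i => (μ i + k * c i).toNat)
    ?_ ?_ ?_
  · intro k hk
    exact ⟨k, fun i => by simpa using hk i⟩
  · intro k l hk hl hkl
    have h1 := DFunLike.congr_fun hkl i
    simp only [Finsupp.equivFunOnFinite_symm_apply_apply] at h1
    have h2 := hk i
    have h3 := hl i
    have h4 : k * c i = l * c i := by omega
    exact mul_right_cancel₀ hi h4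
  · rintro γ ⟨k, hk⟩
    refine ⟨k, fun i => ?_, ?_⟩
    · rw [← hk]; positivity
    · ext i
      simp [← hk]

lemma finite_lineSet {i₀ j₀ : Fin n} (hi₀ : 0 < c i₀) (hj₀ : c j₀ < 0) (μ : Fin n → ℤ) :
    (lineSet c μ).Finite := by
  refine ((finite_lineParam hi₀ hj₀ μ).image fun k =>
    Finsupp.equivFunOnFinite.symm fun i => (μ i + k * c i).toNat).subset ?_
  rintro γ ⟨k, hk⟩
  refine ⟨k, fun i => ?_, ?_⟩
  · rw [← hk]; positivity
  · ext i
    simp [← hk]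

lemma exists_eq_Icc {T : Set ℤ} (hT : T.Finite) (hc : T.OrdConnected) :
    ∃ a b : ℤ, T = Set.Icc a b := by
  rcases T.eq_empty_or_nonempty with rfl | hne
  · exact ⟨1, 0, by simp⟩
  · obtain ⟨a, ha, hamin⟩ := Set.exists_min_image T id hT hne
    obtain ⟨b, hb, hbmax⟩ := Set.exists_max_image T id hT hne
    exact ⟨a, b, Set.Subset.antisymm (fun k hk => ⟨hamin k hk, hbmax k hk⟩) (hc.out ha hb)⟩

lemma ncard_Icc_int (a b : ℤ) : (Set.Icc a b).ncard = (b + 1 - a).toNat := by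
  rw [← Finset.coe_Icc, Set.ncard_coe_finset, Int.card_Icc]

lemma ncard_le_ncard_shift_add {T : Set ℤ} (hT : T.Finite) (hc : T.OrdConnected) (d : ℕ) :
    T.ncard ≤ {k ∈ T | k + d ∈ T}.ncard + d := by
  obtain ⟨a, b, rfl⟩ := exists_eq_Icc hT hc
  have : {k ∈ Set.Icc a b | k + d ∈ Set.Icc a b} = Set.Icc a (b - d) := by
    ext k; simp only [Set.mem_ofPred_eq, Set.mem_Icc]; omega
  rw [this, ncard_Icc_int, ncard_Icc_int]
  omega

lemma ncard_shift_add_le_ncard {T : Set ℤ} (hT : T.Finite) (hc : T.OrdConnected) {d : ℕ} {e : ℤ}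
    (h : ∀ k, e ≤ k → k < e + d → k ∈ T) : {k ∈ T | k + d ∈ T}.ncard + d ≤ T.ncard := by
  obtain ⟨a, b, rfl⟩ := exists_eq_Icc hT hc
  have : {k ∈ Set.Icc a b | k + d ∈ Set.Icc a b} = Set.Icc a (b - d) := by
    ext k; simp only [Set.mem_ofPred_eq, Set.mem_Icc]; omega
  rw [this, ncard_Icc_int, ncard_Icc_int]
  rcases Nat.eq_zero_or_pos d with rfl | hd
  · simp
  · have h1 := (h e le_rfl (by omega)).1
    have h2 := (h (e + d - 1) (by omega) (by omega)).2
    omega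

/-! ### Solving `X^α = G A + H B` -/

lemma finrank_restrictSupport {T : Set (Fin n →₀ ℕ)} :
    Module.finrank K (restrictSupport K T) = T.ncard := by
  rw [Module.finrank_eq_nat_card_basis (basisRestrictSupport K T)]
  rfl

lemma finite_restrictSupport {T : Set (Fin n →₀ ℕ)} (hT : T.Finite) :
    Module.Finite K (restrictSupport K T) := by
  have := hT.to_subtype
  exact Module.Finite.of_basis (basisRestrictSupport K T)

lemma add_mem_lineSet {μ ν : Fin n → ℤ} {α β : Fin n →₀ ℕ} (hα : α ∈ lineSet c μ)
    (hβ : β ∈ lineSet c ν) : α + β ∈ lineSet c (fun i => μ i + ν i) := by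
  obtain ⟨k, hk⟩ := hα
  obtain ⟨l, hl⟩ := hβ
  refine ⟨k + l, fun i => ?_⟩
  rw [Finsupp.add_apply, Nat.cast_add, hk, hl]
  ring

/-- Let `G` and `H` be coprime polynomials supported on parallel lines, no variable dividing `G`.
A monomial `X^α` with `α` in `supp (G H) + ℝ c + ℝ_{≥0}ⁿ` is a combination `G A + H B` with `A`
and `B` supported on the lines forced by homogeneity.

The kernel of `(A, B) ↦ G A + H B` consists of the pairs `(-H D, G D)`, and the number of
exponents on the lines shows that the map is onto. -/
theorem exists_eq_mul_add_mul
    (hprim : ∀ v : Fin n → ℤ, (∃ t : ℝ, realVec v = t • realVec c) → ∃ k : ℤ, v = k • c)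
    {i₀ j₀ : Fin n} (hi₀ : 0 < c i₀) (hj₀ : c j₀ < 0) {G H : MvPolynomial (Fin n) K}
    (hG0 : G ≠ 0) (hcop : IsRelPrime G H)
    {p q : Fin n →₀ ℕ} {d : ℕ} (hp : ∀ i, (p i : ℤ) = d * max 0 (-c i))
    (hGp : ∀ α ∈ G.support, α ∈ lineSet c (intVec p))
    (hHq : ∀ α ∈ H.support, α ∈ lineSet c (intVec q))
    {α : Fin n →₀ ℕ} {t : ℝ} (hα : toPoint p + toPoint q + t • realVec c ≤ toPoint α) :
    ∃ A B : MvPolynomial (Fin n) K,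
      (∀ β ∈ A.support, β ∈ lineSet c (intVec α - intVec p)) ∧
      (∀ β ∈ B.support, β ∈ lineSet c (intVec α - intVec q)) ∧
      monomial α 1 = G * A + H * B := by
  classical
  have hc : c ≠ 0 := by rintro rfl; exact lt_irrefl _ hi₀
  let V := fun μ : Fin n → ℤ => restrictSupport K (lineSet c μ)
  have hVfin : ∀ μ, Module.Finite K (V μ) := fun μ =>
    finite_restrictSupport (finite_lineSet hi₀ hj₀ μ)
  have hVrank : ∀ μ, Module.finrank K (V μ) = (lineParam c μ).ncard := fun μ => by
    rw [finrank_restrictSupport, ncard_lineSet hc]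
  have hmul : ∀ {F D : MvPolynomial (Fin n) K} {μ ν ρ : Fin n → ℤ},
      (∀ β ∈ F.support, β ∈ lineSet c μ) → D ∈ V ν → (∀ i, μ i + ν i = ρ i) → F * D ∈ V ρ := by
    intro F D μ ν ρ hF hD hρ
    rw [mem_restrictSupport_iff] at hD ⊢
    intro γ hγ
    obtain ⟨a, ha, b, hb, rfl⟩ := Finset.mem_add.1 (support_mul _ _ hγ)
    have := add_mem_lineSet (hF a ha) (hD hb)
    rwa [funext hρ] at this
  let V₁ := V (intVec α - intVec p)
  let V₂ := V (intVec α - intVec q)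
  have hV₁ : Module.Finite K V₁ := hVfin _
  have hV₂ : Module.Finite K V₂ := hVfin _
  let Φ : V₁ × V₂ →ₗ[K] MvPolynomial (Fin n) K :=
    (LinearMap.mulLeft K G ∘ₗ V₁.subtype).coprod (LinearMap.mulLeft K H ∘ₗ V₂.subtype)
  have hΦ : ∀ A B, Φ (A, B) = G * A + H * B := fun A B => by simp [Φ]
  let ι := V₁.subtype.prodMap V₂.subtype
  have hι : Function.Injective ι := by
    simp only [ι, LinearMap.coe_prodMap]
    exact Function.Injective.prodMap V₁.injective_subtype V₂.injective_subtype
  let Ψ : MvPolynomial (Fin n) K →ₗ[K] MvPolynomial (Fin n) K × MvPolynomial (Fin n) K :=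
    (-LinearMap.mulLeft K H).prod (LinearMap.mulLeft K G)
  have hΨ : ∀ D, Ψ D = (-(H * D), G * D) := fun D => by simp [Ψ]
  -- the kernel
  have hker : Module.finrank K (LinearMap.ker Φ) ≤
      (lineParam c (fun i => (intVec α - intVec q) i - intVec p i)).ncard := by
    rw [← hVrank, (Submodule.equivMapOfInjective ι hι (LinearMap.ker Φ)).finrank_eq]
    have := hVfin fun i => (intVec α - intVec q) i - intVec p i
    refine (Submodule.finrank_mono (t := (V fun i => (intVec α - intVec q) i - intVec p i).map Ψ)
      ?_).trans (Submodule.finrank_map_le _ _)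
    rintro _ ⟨⟨⟨A, hA⟩, ⟨B, hB⟩⟩, hker, rfl⟩
    have hAB0 : G * A + H * B = 0 := by
      rw [← hΦ ⟨A, hA⟩ ⟨B, hB⟩]; exact hker
    have hdvd : G ∣ H * B := ⟨-A, by rw [mul_neg]; exact eq_neg_of_add_eq_zero_right hAB0⟩
    obtain ⟨D, rfl⟩ := hcop.dvd_of_dvd_mul_left hdvd
    refine ⟨D, ?_, ?_⟩
    · rw [SetLike.mem_coe, mem_restrictSupport_iff]
      intro δ hδ
      have hD0 : D ≠ 0 := by rintro rfl; simp at hδ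
      have hGD : D * G ≠ 0 := mul_ne_zero hD0 hG0
      rw [mul_comm] at hB
      have hB := (mem_restrictSupport_iff K).1 hB
      obtain ⟨γ, hγ⟩ := support_nonempty.2 hGD
      obtain ⟨b, hb, a, ha, rfl⟩ := Finset.mem_add.1 (support_mul _ _ hγ)
      obtain ⟨k, hk⟩ := hB hγ
      obtain ⟨l, hl⟩ := hGp a ha
      obtain ⟨r, hr⟩ := support_subset_lineSet_of_mul hprim hi₀ hj₀ hGD
        (fun γ hγ => hB hγ) hb δ hδ
      refine ⟨r + k - l, fun i => ?_⟩
      have h1 := hk i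
      have h2 := hl i
      have h3 := hr i
      rw [Finsupp.add_apply, Nat.cast_add] at h1
      simp only [intVec, Pi.sub_apply] at h1 h2 h3 ⊢
      rw [h3]
      linear_combination h1 - h2
    · rw [hΨ]
      refine Prod.ext ?_ rfl
      apply mul_left_cancel₀ hG0
      change G * -(H * D) = G * A
      linear_combination -hAB0
  have hle : LinearMap.range Φ ≤ V (intVec α) := by
    rintro _ ⟨⟨A, B⟩, rfl⟩
    rw [hΦ]
    refine add_mem (hmul hGp A.2 fun i => ?_) (hmul hHq B.2 fun i => ?_) <;>
      simp [intVec]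
  have hrn := LinearMap.finrank_range_add_finrank_ker Φ
  rw [Module.finrank_prod, hVrank, hVrank] at hrn
  -- the number of exponents on the lines
  have hsub : ∀ μ : Fin n → ℤ, (fun i => μ i - intVec p i) =
      fun i => μ i - d * max 0 (-c i) := by
    intro μ; funext i; rw [← hp i]; rfl
  have hcount₁ : (lineParam c (intVec α)).ncard ≤
      (lineParam c (intVec α - intVec p)).ncard + d := by
    have h1 := ncard_le_ncard_shift_add (finite_lineParam hi₀ hj₀ (intVec α))
      (ordConnected_lineParam _) d
    rwa [← lineParam_sub, ← hsub] at h1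
  have hcount₂ : (lineParam c (fun i => (intVec α - intVec q) i - intVec p i)).ncard + d ≤
      (lineParam c (intVec α - intVec q)).ncard := by
    rw [hsub, lineParam_sub]
    refine ncard_shift_add_le_ncard (finite_lineParam hi₀ hj₀ _) (ordConnected_lineParam _)
      (e := ⌈-t⌉) fun k hk₁ hk₂ i => ?_
    have h1 : -t ≤ k := (Int.le_ceil _).trans (by exact_mod_cast hk₁)
    have h2 : (k : ℝ) ≤ d - t := by
      have h3 : (k : ℝ) + 1 ≤ ⌈-t⌉ + d := by exact_mod_cast hk₂
      have h4 := Int.ceil_lt_add_one (-t)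
      linarith
    have h5 := hα i
    simp only [Pi.add_apply, Pi.smul_apply, smul_eq_mul, toPoint, realVec] at h5
    have h6 : (p i : ℝ) = d * max 0 (-(c i : ℝ)) := by exact_mod_cast hp i
    have h7 : (0 : ℝ) ≤ (α i : ℝ) - q i + k * c i := by
      rcases le_total 0 (c i : ℝ) with hci | hci
      · have h8 : 0 ≤ (t + k) * (c i : ℝ) := mul_nonneg (by linarith) hci
        have h9 : (0 : ℝ) ≤ p i := by positivity
        linarith
      · rw [max_eq_right (by linarith)] at h6
        have h8 : (d : ℝ) * c i ≤ (t + k) * c i :=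
          mul_le_mul_of_nonpos_right (by linarith) hci
        linarith
    simp only [Pi.sub_apply, intVec]
    exact_mod_cast h7
  have hfin := hVfin (intVec α)
  have heq : LinearMap.range Φ = V (intVec α) := by
    refine Submodule.eq_of_le_of_finrank_le hle ?_
    rw [hVrank]
    omega
  have hmem : monomial α 1 ∈ V (intVec α) :=
    (monomial_mem_restrictSupport K).2 (Or.inl (self_mem_lineSet c α))
  rw [← heq] at hmem
  obtain ⟨⟨A, B⟩, hsum⟩ := hmem
  exact ⟨A, B, fun β hβ => (mem_restrictSupport_iff K).1 A.2 hβ,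
    fun β hβ => (mem_restrictSupport_iff K).1 B.2 hβ, by rw [← hsum, hΦ]⟩

end Line

/-! ### Successive approximation of the factors -/

section Approximation

open IsLocalRing MvPolynomial

variable {n : ℕ}

/-- The exponents in `β + ℝ c + ℝ_{≥0}ⁿ` whose `ξ`-weight is at least `s`. -/
def coneSet (ξ : Fin n → ℝ) (c : Fin n → ℤ) (β : Fin n →₀ ℕ) (s : ℝ) : Set (Fin n →₀ ℕ) :=
  {α | s ≤ ξ ⬝ᵥ toPoint α ∧ ∃ t : ℝ, toPoint β + t • realVec c ≤ toPoint α}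

variable {ξ : Fin n → ℝ} {c : Fin n → ℤ}

lemma add_mem_coneSet {β₁ β₂ α₁ α₂ : Fin n →₀ ℕ} {s₁ s₂ s : ℝ} (hs : s ≤ s₁ + s₂)
    (h₁ : α₁ ∈ coneSet ξ c β₁ s₁) (h₂ : α₂ ∈ coneSet ξ c β₂ s₂) :
    α₁ + α₂ ∈ coneSet ξ c (β₁ + β₂) s := by
  obtain ⟨hw₁, t₁, ht₁⟩ := h₁
  obtain ⟨hw₂, t₂, ht₂⟩ := h₂
  refine ⟨?_, t₁ + t₂, ?_⟩
  · rw [toPoint_add, dotProduct_add]; linarith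
  · rw [toPoint_add, toPoint_add, add_smul, add_add_add_comm]
    exact add_le_add ht₁ ht₂

lemma coneSet_anti {β : Fin n →₀ ℕ} {s s' : ℝ} (h : s ≤ s') :
    coneSet ξ c β s' ⊆ coneSet ξ c β s := fun _ hα => ⟨h.trans hα.1, hα.2⟩

lemma toPoint_eq_of_mem_lineSet {μ : Fin n → ℤ} {γ : Fin n →₀ ℕ} (h : γ ∈ lineSet c μ) :
    ∃ k : ℤ, toPoint γ = realVec μ + (k : ℝ) • realVec c := by
  obtain ⟨k, hk⟩ := h
  refine ⟨k, ?_⟩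
  funext i
  simp only [toPoint, realVec, Pi.add_apply, Pi.smul_apply, smul_eq_mul]
  exact_mod_cast hk i

lemma dotProduct_eq_of_mem_lineSet (hξc : ξ ⬝ᵥ realVec c = 0) {μ : Fin n → ℤ} {γ : Fin n →₀ ℕ}
    (h : γ ∈ lineSet c μ) : ξ ⬝ᵥ toPoint γ = ξ ⬝ᵥ realVec μ := by
  obtain ⟨k, hk⟩ := toPoint_eq_of_mem_lineSet h
  rw [hk, dotProduct_add, dotProduct_smul, hξc, smul_zero, add_zero]

lemma realVec_intVec (α : Fin n →₀ ℕ) : realVec (intVec α) = toPoint α := by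
  funext i; simp [realVec, intVec, toPoint]

lemma realVec_sub (μ ν : Fin n → ℤ) : realVec (μ - ν) = realVec μ - realVec ν := by
  funext i; simp [realVec]

lemma mem_coneSet_of_mem_lineSet (hξc : ξ ⬝ᵥ realVec c = 0) {α β γ : Fin n →₀ ℕ} {s : ℝ}
    (hα : α ∈ coneSet ξ c β s) (hγ : γ ∈ lineSet c (intVec α)) : γ ∈ coneSet ξ c β s := by
  obtain ⟨hw, t, ht⟩ := hα
  obtain ⟨k, hk⟩ := toPoint_eq_of_mem_lineSet hγ
  refine ⟨?_, t + k, ?_⟩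
  · rwa [dotProduct_eq_of_mem_lineSet hξc hγ, realVec_intVec]
  · rw [hk, realVec_intVec, add_smul, ← add_assoc]
    exact add_le_add ht le_rfl

/-- If `α` lies in the cone of `p + q`, the line through `α - q` lies in the cone of `p`. -/
lemma mem_coneSet_of_mem_lineSet_sub (hξc : ξ ⬝ᵥ realVec c = 0) {α p q γ : Fin n →₀ ℕ} {s : ℝ}
    (hα : α ∈ coneSet ξ c (p + q) s) (hγ : γ ∈ lineSet c (intVec α - intVec q)) :
    γ ∈ coneSet ξ c p (s - ξ ⬝ᵥ toPoint q) := by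
  obtain ⟨hw, t, ht⟩ := hα
  obtain ⟨k, hk⟩ := toPoint_eq_of_mem_lineSet hγ
  rw [realVec_sub, realVec_intVec, realVec_intVec] at hk
  refine ⟨?_, t + k, ?_⟩
  · rw [dotProduct_eq_of_mem_lineSet hξc hγ, realVec_sub, realVec_intVec, realVec_intVec,
      dotProduct_sub]
    linarith
  · rw [hk, add_smul, ← add_assoc]
    refine add_le_add ?_ le_rfl
    rw [le_sub_iff_add_le]
    rw [toPoint_add] at ht
    rwa [add_right_comm]

lemma add_single_mem_coneSet {ε : ℝ} (hε : ∀ i, ε ≤ ξ i) {α β γ : Fin n →₀ ℕ}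
    {s : ℝ} (hα : α ∈ coneSet ξ c β s) (hγ : γ.degree = 1) : α + γ ∈ coneSet ξ c β (s + ε) := by
  have h1 : γ ∈ {d : Fin n →₀ ℕ | d.degree = 1} := hγ
  rw [← Finsupp.range_single_one] at h1
  obtain ⟨i, rfl⟩ := h1
  have h2 : Finsupp.single i 1 ∈ coneSet ξ c 0 ε := by
    refine ⟨?_, 0, fun j => by simp [toPoint]⟩
    rw [dotProduct, Finset.sum_eq_single i]
    · simpa [toPoint] using hε i
    · intro j _ hj; simp [toPoint, hj]
    · simp
  simpa using add_mem_coneSet le_rfl hα h2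

variable {S : Type*} [CommRing S] [IsLocalRing S] {x : Fin n → S}

/-- A term with nonunit coefficient lies one step deeper in the filtration. -/
lemma mul_monomialAt_mem (hx : Ideal.span (Set.range x) = maximalIdeal S) {ε : ℝ}
    (hε : ∀ i, ε ≤ ξ i) {α β : Fin n →₀ ℕ} {s : ℝ} (hα : α ∈ coneSet ξ c β s) {r : S}
    (hr : r ∈ maximalIdeal S) :
    r * monomialAt x α ∈ monomialIdeal x (coneSet ξ c β (s + ε)) := by
  rw [← hx, span_range_eq_monomialIdeal] at hr
  rw [mul_comm]
  refine mul_mem_monomialIdeal (T₁ := {α}) ?_ (monomialAt_mem rfl) hr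
  rintro _ rfl γ hγ
  exact add_single_mem_coneSet hε hα hγ

/-- A lift of a polynomial over the residue field whose coefficients are units or zero. -/
lemma exists_unit_lift (P : MvPolynomial (Fin n) (ResidueField S)) :
    ∃ Q : MvPolynomial (Fin n) S, map (residue S) Q = P ∧ Q.support = P.support ∧
      ∀ α, Q.coeff α = 0 ∨ IsUnit (Q.coeff α) := by
  classical
  choose σ hσ using fun a : ResidueField S => residue_surjective a
  let Q : MvPolynomial (Fin n) S := ∑ α ∈ P.support, monomial α (σ (P.coeff α))
  have hcoeff : ∀ α, Q.coeff α = if α ∈ P.support then σ (P.coeff α) else 0 := by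
    intro α
    simp only [Q, coeff_sum, coeff_monomial]
    simp
  have hunit : ∀ α ∈ P.support, IsUnit (Q.coeff α) := by
    intro α hα
    rw [hcoeff, if_pos hα]
    refine (residue_ne_zero_iff_isUnit _).1 ?_
    rw [hσ]
    exact mem_support_iff.1 hα
  refine ⟨Q, ?_, ?_, fun α => ?_⟩
  · ext α
    rw [coeff_map, hcoeff]
    split_ifs with h
    · exact hσ _
    · rw [map_zero, notMem_support_iff.1 h]
  · ext α
    rw [mem_support_iff]
    constructor
    · intro h
      by_contra hne
      rw [hcoeff, if_neg hne] at h
      exact h rfl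
    · exact fun h => (hunit α h).ne_zero
  · by_cases h : α ∈ P.support
    · exact Or.inr (hunit α h)
    · left; rw [hcoeff, if_neg h]

variable {ε : ℝ} {p q : Fin n →₀ ℕ} {d : ℕ} {G H : MvPolynomial (Fin n) S} {i₀ j₀ : Fin n}

/-- The linearized factorization problem is solvable up to terms of higher order. -/
lemma exists_linear_step (hx : Ideal.span (Set.range x) = maximalIdeal S)
    (hprim : ∀ v : Fin n → ℤ, (∃ t : ℝ, realVec v = t • realVec c) → ∃ k : ℤ, v = k • c)
    (hi₀ : 0 < c i₀) (hj₀ : c j₀ < 0) (hξc : ξ ⬝ᵥ realVec c = 0)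
    (hε : ∀ i, ε ≤ ξ i) (hp : ∀ i, (p i : ℤ) = d * max 0 (-c i))
    (hG0 : map (residue S) G ≠ 0) (hcop : IsRelPrime (map (residue S) G) (map (residue S) H))
    (hGp : ∀ α ∈ G.support, α ∈ lineSet c (intVec p))
    (hHq : ∀ α ∈ H.support, α ∈ lineSet c (intVec q)) {s : ℝ} {r : S}
    (hr : r ∈ monomialIdeal x (coneSet ξ c (p + q) s)) :
    ∃ a ∈ monomialIdeal x (coneSet ξ c q (s - ξ ⬝ᵥ toPoint p)),
      ∃ b ∈ monomialIdeal x (coneSet ξ c p (s - ξ ⬝ᵥ toPoint q)),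
        r - eval x G * a - eval x H * b ∈ monomialIdeal x (coneSet ξ c (p + q) (s + ε)) := by
  classical
  induction hr using Submodule.span_induction with
  | zero => exact ⟨0, zero_mem _, 0, zero_mem _, by simp⟩
  | add r₁ r₂ _ _ h₁ h₂ =>
    obtain ⟨a₁, ha₁, b₁, hb₁, hr₁⟩ := h₁
    obtain ⟨a₂, ha₂, b₂, hb₂, hr₂⟩ := h₂
    refine ⟨a₁ + a₂, add_mem ha₁ ha₂, b₁ + b₂, add_mem hb₁ hb₂, ?_⟩
    convert add_mem hr₁ hr₂ using 1
    ring
  | smul u r _ h =>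
    obtain ⟨a, ha, b, hb, hr⟩ := h
    refine ⟨u * a, Ideal.mul_mem_left _ _ ha, u * b, Ideal.mul_mem_left _ _ hb, ?_⟩
    convert Ideal.mul_mem_left _ u hr using 1
    rw [smul_eq_mul]
    ring
  | mem r hr =>
    obtain ⟨α, hα, rfl⟩ := hr
    obtain ⟨t, ht⟩ := hα.2
    rw [toPoint_add] at ht
    obtain ⟨A, B, hA, hB, hAB⟩ := exists_eq_mul_add_mul hprim hi₀ hj₀ hG0 hcop hp
      (fun β hβ => hGp β (support_map_subset _ _ hβ))
      (fun β hβ => hHq β (support_map_subset _ _ hβ)) ht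
    obtain ⟨A', hA'map, hA'supp, -⟩ := exists_unit_lift A
    obtain ⟨B', hB'map, hB'supp, -⟩ := exists_unit_lift B
    rw [← hA'supp] at hA
    rw [← hB'supp] at hB
    refine ⟨eval x A', eval_mem_monomialIdeal fun β hβ => ?_, eval x B',
      eval_mem_monomialIdeal fun β hβ => ?_, ?_⟩
    · rw [add_comm] at hα
      exact mem_coneSet_of_mem_lineSet_sub hξc hα (hA β hβ)
    · exact mem_coneSet_of_mem_lineSet_sub hξc hα (hB β hβ)
    -- the error is a polynomial on the line through `α` with coefficients in `𝔪`
    set D := monomial α 1 - G * A' - H * B' with hD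
    have hDeval : monomialAt x α - eval x G * eval x A' - eval x H * eval x B' = eval x D := by
      rw [hD, map_sub, map_sub, map_mul, map_mul, eval_monomial, one_mul, monomialAt,
        Finsupp.prod_fintype _ _ (by simp)]
    have hDmap : map (residue S) D = 0 := by
      rw [hD, map_sub, map_sub, map_mul, map_mul, hA'map, hB'map, map_monomial, map_one, hAB]
      ring
    have hmulline : ∀ {F F' : MvPolynomial (Fin n) S} {ρ : Fin n →₀ ℕ},
        (∀ β ∈ F.support, β ∈ lineSet c (intVec ρ)) →
        (∀ β ∈ F'.support, β ∈ lineSet c (intVec α - intVec ρ)) →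
        ∀ γ ∈ (F * F').support, γ ∈ lineSet c (intVec α) := by
      intro F F' ρ hF hF' γ hγ
      obtain ⟨β, hβ, β', hβ', rfl⟩ := Finset.mem_add.1 (support_mul _ _ hγ)
      have h1 := add_mem_lineSet (hF β hβ) (hF' β' hβ')
      have h2 : (fun i => intVec ρ i + (intVec α - intVec ρ) i) = intVec α := by
        funext i; simp
      rwa [h2] at h1
    have hDsupp : ∀ γ ∈ D.support, γ ∈ lineSet c (intVec α) := by
      intro γ hγ
      rw [hD] at hγ
      rcases Finset.mem_union.1 (support_sub _ _ _ hγ) with hγ | hγ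
      · rcases Finset.mem_union.1 (support_sub _ _ _ hγ) with hγ | hγ
        · have h1 := support_monomial_subset hγ
          rw [Finset.mem_singleton] at h1
          rw [h1]
          exact self_mem_lineSet c α
        · exact hmulline hGp hA γ hγ
      · exact hmulline hHq hB γ hγ
    rw [hDeval, eval_eq_sum_monomialAt]
    refine Ideal.sum_mem _ fun γ hγ => mul_monomialAt_mem hx hε
      (mem_coneSet_of_mem_lineSet hξc hα (hDsupp γ hγ)) ?_
    rw [← residue_eq_zero_iff, ← coeff_map, hDmap, coeff_zero]

lemma degree_le_of_weight (hξ : ∀ i, 0 < ξ i) (hε0 : 0 < ε) (w : ℝ) (N : ℕ) :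
    ∃ K : ℕ, ∀ k ≥ K, ∀ α : Fin n →₀ ℕ, w + (k + 1) * ε ≤ ξ ⬝ᵥ toPoint α → N ≤ α.degree := by
  set M := ∑ i, ξ i + 1 with hM
  have hM0 : 0 < M := by
    have := Finset.sum_nonneg fun i (_ : i ∈ Finset.univ) => (hξ i).le
    linarith
  obtain ⟨K, hK⟩ := exists_nat_ge ((N * M - w) / ε)
  refine ⟨K, fun k hk α hα => ?_⟩
  have h1 : ξ ⬝ᵥ toPoint α ≤ M * α.degree := by
    rw [Finsupp.degree_eq_sum, Nat.cast_sum, Finset.mul_sum]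
    refine Finset.sum_le_sum fun i _ => mul_le_mul_of_nonneg_right ?_ (Nat.cast_nonneg _)
    have := Finset.single_le_sum (fun j (_ : j ∈ Finset.univ) => (hξ j).le) (Finset.mem_univ i)
    linarith
  rw [div_le_iff₀ hε0] at hK
  have h2 : (K : ℝ) * ε ≤ k * ε := mul_le_mul_of_nonneg_right (by exact_mod_cast hk) hε0.le
  have h3 : M * N ≤ M * α.degree := by linarith
  exact_mod_cast le_of_mul_le_mul_left h3 hM0

lemma exists_pow_le_weight (hx : Ideal.span (Set.range x) = maximalIdeal S)
    (hε0 : 0 < ε) (hε : ∀ i, ε ≤ ξ i) (w : ℝ) :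
    ∃ N : ℕ, maximalIdeal S ^ N ≤ monomialIdeal x {α | w ≤ ξ ⬝ᵥ toPoint α} := by
  obtain ⟨N, hN⟩ := exists_nat_ge (w / ε)
  refine ⟨N, ?_⟩
  rw [← hx]
  refine (pow_le_monomialIdeal N).trans (monomialIdeal_mono fun α hα => ?_)
  have h1 : α.degree = N := hα
  rw [div_le_iff₀ hε0, ← h1, Finsupp.degree_eq_sum, Nat.cast_sum, Finset.sum_mul] at hN
  refine hN.trans (Finset.sum_le_sum fun i _ => ?_)
  rw [mul_comm]
  exact mul_le_mul_of_nonneg_right (hε i) (Nat.cast_nonneg _)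

/-- Hensel's lemma along a loose edge: if `f` agrees with the product of (lifts of) the coprime
polynomials `G` and `H` up to terms of higher order in the cone of `p + q`, then `f` factors
with factors that agree with `G` and `H` up to terms of higher weight. -/
theorem exists_factors [IsAdicComplete (maximalIdeal S) S]
    (hx : Ideal.span (Set.range x) = maximalIdeal S)
    (hprim : ∀ v : Fin n → ℤ, (∃ t : ℝ, realVec v = t • realVec c) → ∃ k : ℤ, v = k • c)
    (hi₀ : 0 < c i₀) (hj₀ : c j₀ < 0) (hξ : ∀ i, 0 < ξ i) (hξc : ξ ⬝ᵥ realVec c = 0)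
    (hε0 : 0 < ε) (hε : ∀ i, ε ≤ ξ i)
    (hp : ∀ i, (p i : ℤ) = d * max 0 (-c i))
    (hG0 : map (residue S) G ≠ 0) (hcop : IsRelPrime (map (residue S) G) (map (residue S) H))
    (hGp : ∀ α ∈ G.support, α ∈ lineSet c (intVec p))
    (hHq : ∀ α ∈ H.support, α ∈ lineSet c (intVec q)) {f : S}
    (hf : f - eval x G * eval x H ∈
      monomialIdeal x (coneSet ξ c (p + q) (ξ ⬝ᵥ toPoint p + ξ ⬝ᵥ toPoint q + ε))) :
    ∃ g h : S, f = g * h ∧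
      g - eval x G ∈ monomialIdeal x {α | ξ ⬝ᵥ toPoint p + ε ≤ ξ ⬝ᵥ toPoint α} ∧
      h - eval x H ∈ monomialIdeal x {α | ξ ⬝ᵥ toPoint q + ε ≤ ξ ⬝ᵥ toPoint α} := by
  classical
  set wp := ξ ⬝ᵥ toPoint p with hwp
  set wq := ξ ⬝ᵥ toPoint q with hwq
  let Inv : ℕ → S × S → Prop := fun k z =>
    z.1 - eval x G ∈ monomialIdeal x (coneSet ξ c p (wp + ε)) ∧
    z.2 - eval x H ∈ monomialIdeal x (coneSet ξ c q (wq + ε)) ∧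
    f - z.1 * z.2 ∈ monomialIdeal x (coneSet ξ c (p + q) (wp + wq + (k + 1) * ε))
  let Near : ℕ → S × S → S × S → Prop := fun k z z' =>
    z'.1 - z.1 ∈ monomialIdeal x (coneSet ξ c p (wp + (k + 1) * ε)) ∧
    z'.2 - z.2 ∈ monomialIdeal x (coneSet ξ c q (wq + (k + 1) * ε))
  have hkε : ∀ k : ℕ, ε ≤ (k + 1) * ε := fun k => by
    have : 0 ≤ (k : ℝ) * ε := by positivity
    linarith
  have hstep : ∀ k z, ∃ z', Inv k z → Inv (k + 1) z' ∧ Near k z z' := by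
    rintro k ⟨g, h⟩
    by_cases hz : Inv k (g, h)
    · obtain ⟨hg, hh, hr⟩ := hz
      obtain ⟨a, ha, b, hb, hab⟩ := exists_linear_step hx hprim hi₀ hj₀ hξc hε hp hG0 hcop
        hGp hHq hr
      have ha' : a ∈ monomialIdeal x (coneSet ξ c q (wq + (k + 1) * ε)) := by
        convert ha using 3; ring
      have hb' : b ∈ monomialIdeal x (coneSet ξ c p (wp + (k + 1) * ε)) := by
        convert hb using 3; ring
      refine ⟨(g + b, h + a), fun _ => ⟨⟨?_, ?_, ?_⟩, ?_, ?_⟩⟩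
      · have h1 : b ∈ monomialIdeal x (coneSet ξ c p (wp + ε)) :=
          monomialIdeal_mono (coneSet_anti (by linarith [hkε k])) hb'
        convert add_mem hg h1 using 1
        ring
      · have h1 : a ∈ monomialIdeal x (coneSet ξ c q (wq + ε)) :=
          monomialIdeal_mono (coneSet_anti (by linarith [hkε k])) ha'
        convert add_mem hh h1 using 1
        ring
      · have hk1 : wp + wq + (((k + 1 : ℕ) : ℝ) + 1) * ε = wp + wq + (k + 1) * ε + ε := by
          push_cast; ring
        rw [hk1]
        have h1 := mul_mem_monomialIdeal (fun α hα β hβ => add_mem_coneSet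
          (s := wp + wq + (k + 1) * ε + ε) (by linarith) hα hβ) hg ha'
        have h2 := mul_mem_monomialIdeal (fun α hα β hβ => add_mem_coneSet
          (s := wp + wq + (k + 1) * ε + ε) (by linarith) hα hβ) hb' hh
        have h3 := mul_mem_monomialIdeal (fun α hα β hβ => add_mem_coneSet
          (s := wp + wq + (k + 1) * ε + ε) (by linarith [hkε k]) hα hβ) hb' ha'
        convert sub_mem (sub_mem (sub_mem hab h1) h2) h3 using 1
        simp only
        ring
      · simpa using hb'
      · simpa using ha'
    · exact ⟨(0, 0), fun h => absurd h hz⟩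
  choose F hF using hstep
  let z : ℕ → S × S := fun k => Nat.rec (eval x G, eval x H) (fun k z => F k z) k
  have hinv : ∀ k, Inv k (z k) := by
    intro k
    induction k with
    | zero =>
      refine ⟨?_, ?_, ?_⟩
      · simp [z]
      · simp [z]
      · simpa [z] using hf
    | succ k ih => exact (hF k (z k) ih).1
  have hnear : ∀ k, Near k (z k) (z (k + 1)) := fun k => (hF k (z k) (hinv k)).2
  have hpow : ∀ (β : Fin n →₀ ℕ) (w : ℝ) (N : ℕ), ∃ K : ℕ, ∀ k ≥ K,
      monomialIdeal x (coneSet ξ c β (w + (k + 1) * ε)) ≤ maximalIdeal S ^ N := by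
    intro β w N
    obtain ⟨K, hK⟩ := degree_le_of_weight hξ hε0 w N
    refine ⟨K, fun k hk => ?_⟩
    rw [← hx]
    exact monomialIdeal_le_pow fun α hα => hK k hk α hα.1
  obtain ⟨g, hg⟩ := exists_limit (I := maximalIdeal S) (fun k => (z k).1) fun N => by
    obtain ⟨K, hK⟩ := hpow p wp N
    exact ⟨K, fun k hk => hK k hk (hnear k).1⟩
  obtain ⟨h, hh⟩ := exists_limit (I := maximalIdeal S) (fun k => (z k).2) fun N => by
    obtain ⟨K, hK⟩ := hpow q wq N
    exact ⟨K, fun k hk => hK k hk (hnear k).2⟩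
  refine ⟨g, h, ?_, ?_, ?_⟩
  · rw [← sub_eq_zero]
    apply eq_zero_of_forall_mem_pow (I := maximalIdeal S)
    intro N
    obtain ⟨K₁, hK₁⟩ := hg N
    obtain ⟨K₂, hK₂⟩ := hh N
    obtain ⟨K₃, hK₃⟩ := hpow (p + q) (wp + wq) N
    let k := K₁ + K₂ + K₃
    have h1 := hK₁ k (by simp only [k]; omega)
    have h2 := hK₂ k (by simp only [k]; omega)
    have h3 := hK₃ k (by simp only [k]; omega) (hinv k).2.2
    convert sub_mem (sub_mem h3 (Ideal.mul_mem_right h _ h1))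
      (Ideal.mul_mem_left _ (z k).1 h2) using 1
    ring
  · obtain ⟨N, hN⟩ := exists_pow_le_weight hx hε0 hε (wp + ε)
    obtain ⟨K, hK⟩ := hg N
    have h1 := monomialIdeal_mono (T' := {α | wp + ε ≤ ξ ⬝ᵥ toPoint α})
      (fun α hα => hα.1) (hinv K).1
    convert add_mem (hN (hK K le_rfl)) h1 using 1
    ring
  · obtain ⟨N, hN⟩ := exists_pow_le_weight hx hε0 hε (wq + ε)
    obtain ⟨K, hK⟩ := hh N
    have h1 := monomialIdeal_mono (T' := {α | wq + ε ≤ ξ ⬝ᵥ toPoint α})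
      (fun α hα => hα.1) (hinv K).2.1
    convert add_mem (hN (hK K le_rfl)) h1 using 1
    ring

end Approximation

/-! ### Factorization along a loose edge -/

section Factorization

open IsLocalRing MvPolynomial

variable {n : ℕ}

lemma coeff_symbolicRestriction {R : Type*} [CommRing R] [IsLocalRing R]
    (b : MvPolynomial (Fin n) R) (A : Set (Fin n → ℝ)) (α : Fin n →₀ ℕ) [Decidable (toPoint α ∈ A)] :
    (symbolicRestriction b A).coeff α = if toPoint α ∈ A then residue R (b.coeff α) else 0 := by
  classical
  simp only [symbolicRestriction, coeff_sum, coeff_monomial, Finset.sum_ite_eq',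
    Finset.mem_filter, mem_support_iff]
  by_cases h : b.coeff α = 0
  · simp [h]
  · simp [h]

lemma dotProduct_eq_of_mem_convexHull {B : Set (Fin n → ℝ)} {ξ p : Fin n → ℝ} {m : ℝ}
    (h : ∀ q ∈ B, ξ ⬝ᵥ q = m) (hp : p ∈ convexHull ℝ B) : ξ ⬝ᵥ p = m :=
  convexHull_min (s := B) h (convex_hyperplane (isLinearMap_dotProduct ξ) m) hp

lemma exists_pos_forall_le (s : Finset ℝ) (hs : ∀ r ∈ s, 0 < r) :
    ∃ ε : ℝ, 0 < ε ∧ ∀ r ∈ s, ε ≤ r := by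
  classical
  obtain ⟨ε, hε, hmin⟩ := (insert 1 s).exists_min_image id ⟨1, by simp⟩
  refine ⟨ε, ?_, fun r hr => hmin r (Finset.mem_insert_of_mem hr)⟩
  rcases Finset.mem_insert.1 hε with rfl | h
  · exact one_pos
  · exact hs ε h

/-- If `g` agrees with the value of a `ξ`-homogeneous polynomial `P` up to terms of higher weight,
then the exponents of `P` span a compact face of the Newton polyhedron of `g`, with symbolic
restriction the reduction of `P`. -/
lemma hasSymbolicRestriction_of_sub_mem {S : Type*} [CommRing S] [IsLocalRing S]
    [IsAdicComplete (maximalIdeal S) S] {x : Fin n → S}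
    (hspan : Ideal.span (Set.range x) = maximalIdeal S) (hx : MonomiallyIndependent x)
    {ξ : Fin n → ℝ} (hξ : ∀ i, 0 < ξ i) {w ε : ℝ} (hε : 0 < ε) {P : MvPolynomial (Fin n) S}
    (hPunit : ∀ α, P.coeff α = 0 ∨ IsUnit (P.coeff α)) (hP0 : P ≠ 0)
    (hPw : ∀ α ∈ P.support, ξ ⬝ᵥ toPoint α = w) {g : S}
    (hg : g - eval x P ∈ monomialIdeal x {α | w + ε ≤ ξ ⬝ᵥ toPoint α}) :
    HasSymbolicRestriction x g (convexHull ℝ (toPoint '' (P.support : Set (Fin n →₀ ℕ))))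
      (map (residue S) P) := by
  classical
  obtain ⟨r, hr⟩ := exists_isExpansion hspan (g - eval x P)
  have hup : IsUpperSet {α : Fin n →₀ ℕ | w + ε ≤ ξ ⬝ᵥ toPoint α} := by
    intro α β hle hα
    have h1 : 0 ≤ ξ ⬝ᵥ (toPoint β - toPoint α) :=
      dotProduct_nonneg_of_nonneg (fun i => (hξ i).le) (sub_nonneg.2 (toPoint_mono hle))
    rw [dotProduct_sub] at h1
    have h2 : w + ε ≤ ξ ⬝ᵥ toPoint α := hα
    change w + ε ≤ ξ ⬝ᵥ toPoint β
    linarith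
  have hrw : ∀ α ∈ r.support, w + ε ≤ ξ ⬝ᵥ toPoint α := fun α hα =>
    hx.support_subset hr hup hg hα
  have hP : ∀ α, ξ ⬝ᵥ toPoint α ≠ w → P.coeff α = 0 := fun α hα => by
    by_contra h
    exact hα (hPw α (mem_support_iff.2 h))
  have hr0 : ∀ α, ξ ⬝ᵥ toPoint α = w → r.coeff α = 0 := fun α hα => by
    by_contra h
    have := hrw α (mem_support_iff.2 h)
    linarith
  have hbw : ∀ α, ξ ⬝ᵥ toPoint α = w → (P + r).coeff α = P.coeff α := fun α hα => by
    rw [coeff_add, hr0 α hα, add_zero]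
  have hbne : ∀ α, ξ ⬝ᵥ toPoint α ≠ w → (P + r).coeff α = r.coeff α := fun α hα => by
    rw [coeff_add, hP α hα, zero_add]
  have hb : IsExpansion x g (P + r) := by
    refine ⟨fun α => ?_, by rw [map_add, hr.2]; ring⟩
    by_cases hα : ξ ⬝ᵥ toPoint α = w
    · rw [hbw α hα]; exact hPunit α
    · rw [hbne α hα]; exact hr.1 α
  have hset : (P.support : Set (Fin n →₀ ℕ)) =
      {α | (P + r).coeff α ≠ 0 ∧ ξ ⬝ᵥ toPoint α = w} := by
    ext α
    constructor
    · intro hα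
      have h1 := hPw α hα
      exact ⟨by rw [hbw α h1]; exact mem_support_iff.1 hα, h1⟩
    · rintro ⟨h1, h2⟩
      rw [hbw α h2] at h1
      exact mem_support_iff.2 h1
  obtain ⟨α₀, hα₀⟩ := support_nonempty.2 hP0
  have hface := isCompactFace_of_pos (b := P + r) hξ (m := w) (fun α hα => by
    by_cases h : ξ ⬝ᵥ toPoint α = w
    · exact h.ge
    · rw [hbne α h] at hα
      have := hrw α (mem_support_iff.2 hα)
      linarith) ⟨α₀, by
      have h1 : α₀ ∈ (P.support : Set (Fin n →₀ ℕ)) := hα₀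
      rwa [hset] at h1⟩
  rw [← hset] at hface
  have hrestr : symbolicRestriction (P + r)
      (convexHull ℝ (toPoint '' (P.support : Set (Fin n →₀ ℕ)))) = map (residue S) P := by
    ext α
    rw [coeff_symbolicRestriction, coeff_map]
    split_ifs with h
    · rw [hbw α (dotProduct_eq_of_mem_convexHull ?_ h)]
      rintro _ ⟨β, hβ, rfl⟩
      exact hPw β hβ
    · rw [notMem_support_iff.1 fun hα => h (subset_convexHull _ _ ⟨α, hα, rfl⟩), map_zero]
  rw [← hrestr]
  exact hx.hasSymbolicRestriction hb hface

/-- The Newton polytope of a product of two polynomials supported on parallel segments is the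
Minkowski sum of the Newton polytopes, and the first endpoints add up. -/
lemma convexHull_support_mul {K : Type*} [Field K] {c : Fin n → ℤ} {i₀ : Fin n} (hi₀ : 0 < c i₀)
    {P Q : MvPolynomial (Fin n) K} {p p' q q' : Fin n →₀ ℕ} {d e : ℕ}
    (hp : p ∈ P.support) (hp' : p' ∈ P.support) (hpd : ∀ i, (p' i : ℤ) = p i + d * c i)
    (hP : ∀ α ∈ P.support, ∃ k : ℕ, k ≤ d ∧ ∀ i, (α i : ℤ) = p i + k * c i)
    (hq : q ∈ Q.support) (hq' : q' ∈ Q.support) (hqe : ∀ i, (q' i : ℤ) = q i + e * c i)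
    (hQ : ∀ α ∈ Q.support, ∃ k : ℕ, k ≤ e ∧ ∀ i, (α i : ℤ) = q i + k * c i) :
    p + q ∈ (P * Q).support ∧
      convexHull ℝ (toPoint '' ((P * Q).support : Set (Fin n →₀ ℕ))) =
        convexHull ℝ (toPoint '' (P.support : Set (Fin n →₀ ℕ))) +
          convexHull ℝ (toPoint '' (Q.support : Set (Fin n →₀ ℕ))) := by
  classical
  have key : ∀ {α β α' β' : Fin n →₀ ℕ}, α + β = α' + β' → ∀ {k l k' l' : ℕ},
      (∀ i, (α i : ℤ) = p i + k * c i) → (∀ i, (β i : ℤ) = q i + l * c i) →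
      (∀ i, (α' i : ℤ) = p i + k' * c i) → (∀ i, (β' i : ℤ) = q i + l' * c i) →
      k + l = k' + l' := by
    intro α β α' β' h k l k' l' hk hl hk' hl'
    have h1 := DFunLike.congr_fun h i₀
    rw [Finsupp.add_apply, Finsupp.add_apply] at h1
    zify at h1 ⊢
    rw [hk, hl, hk', hl'] at h1
    exact mul_right_cancel₀ hi₀.ne' (by linarith)
  have hext : ∀ {α α' : Fin n →₀ ℕ} {p : Fin n →₀ ℕ} {k k' : ℕ},
      (∀ i, (α i : ℤ) = p i + k * c i) → (∀ i, (α' i : ℤ) = p i + k' * c i) → k = k' →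
      α = α' := by
    rintro α α' p k _ hk hk' rfl
    ext i
    exact_mod_cast (hk i).trans (hk' i).symm
  have hp0 : ∀ i, (p i : ℤ) = p i + (0 : ℕ) * c i := fun i => by simp
  have hq0 : ∀ i, (q i : ℤ) = q i + (0 : ℕ) * c i := fun i => by simp
  have hlow : p + q ∈ (P * Q).support := by
    rw [mem_support_iff, coeff_mul_of_extreme]
    · exact mul_ne_zero (mem_support_iff.1 hp) (mem_support_iff.1 hq)
    · intro α hα β hβ h
      obtain ⟨k, -, hk⟩ := hP α hα
      obtain ⟨l, -, hl⟩ := hQ β hβ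
      have h1 := key h hk hl hp0 hq0
      exact ⟨hext hk hp0 (by omega), hext hl hq0 (by omega)⟩
  have hhigh : p' + q' ∈ (P * Q).support := by
    rw [mem_support_iff, coeff_mul_of_extreme]
    · exact mul_ne_zero (mem_support_iff.1 hp') (mem_support_iff.1 hq')
    · intro α hα β hβ h
      obtain ⟨k, hkd, hk⟩ := hP α hα
      obtain ⟨l, hle, hl⟩ := hQ β hβ
      have h1 := key h hk hl hpd hqe
      exact ⟨hext hk hpd (by omega), hext hl hqe (by omega)⟩
  refine ⟨hlow, ?_⟩
  rw [← convexHull_add]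
  apply Set.Subset.antisymm
  · refine convexHull_mono ?_
    rintro _ ⟨γ, hγ, rfl⟩
    obtain ⟨α, hα, β, hβ, rfl⟩ := Finset.mem_add.1 (support_mul _ _ hγ)
    exact ⟨_, ⟨α, hα, rfl⟩, _, ⟨β, hβ, rfl⟩, (toPoint_add α β).symm⟩
  · refine convexHull_min ?_ (convex_convexHull ℝ _)
    rintro _ ⟨_, ⟨α, hα, rfl⟩, _, ⟨β, hβ, rfl⟩, rfl⟩
    obtain ⟨k, hkd, hk⟩ := hP α hα
    obtain ⟨l, hle, hl⟩ := hQ β hβ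
    obtain ⟨s, hs0, hs1, hs⟩ : ∃ s : ℝ, 0 ≤ s ∧ s ≤ 1 ∧ s * (d + e) = k + l := by
      rcases Nat.eq_zero_or_pos (d + e) with h0 | h0
      · refine ⟨0, le_rfl, zero_le_one, ?_⟩
        have h1 : k + l = 0 := by omega
        rw [zero_mul]
        exact_mod_cast h1.symm
      · have h1 : (0 : ℝ) < d + e := by exact_mod_cast h0
        refine ⟨(k + l) / (d + e), by positivity, ?_, div_mul_cancel₀ _ h1.ne'⟩
        rw [div_le_one h1]
        exact_mod_cast (by omega : k + l ≤ d + e)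
    have hseg := (convex_convexHull ℝ (toPoint '' ((P * Q).support : Set (Fin n →₀ ℕ))))
      (subset_convexHull _ _ ⟨_, hlow, rfl⟩) (subset_convexHull _ _ ⟨_, hhigh, rfl⟩)
      (sub_nonneg.2 hs1) hs0 (sub_add_cancel _ _)
    convert hseg using 1
    funext i
    have e1 : (α i : ℝ) = p i + k * c i := by exact_mod_cast hk i
    have e2 : (β i : ℝ) = q i + l * c i := by exact_mod_cast hl i
    have e3 : (p' i : ℝ) = p i + d * c i := by exact_mod_cast hpd i
    have e4 : (q' i : ℝ) = q i + e * c i := by exact_mod_cast hqe i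
    simp only [toPoint, Pi.add_apply, Pi.smul_apply, smul_eq_mul, Finsupp.add_apply,
      Nat.cast_add, e1, e2, e3, e4]
    linear_combination (-(c i : ℝ)) * hs

/-- The factorization along a loose edge, for a complete local ring whose maximal ideal is
generated by monomially independent elements. The lifts of `G` and `H` whose coefficients are units
or zero are the starting point of the successive approximation. -/
theorem exists_factorization_of_isLooseEdge {S : Type*} [CommRing S] [IsLocalRing S]
    [IsAdicComplete (maximalIdeal S) S] {x : Fin n → S}
    (hspan : Ideal.span (Set.range x) = maximalIdeal S) (hx : MonomiallyIndependent x)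
    {f : S} {a : MvPolynomial (Fin n) S} (ha : IsExpansion x f a)
    {E : Set (Fin n → ℝ)} (hE : IsLooseEdge (newtonPolyhedron a) E)
    {G H : MvPolynomial (Fin n) (ResidueField S)} (hGH : symbolicRestriction a E = G * H)
    (hcop : IsRelPrime G H) (hG : ∀ i, ¬ X i ∣ G) :
    ∃ g h : S, f = g * h ∧ ∃ E₁ E₂ : Set (Fin n → ℝ),
      HasSymbolicRestriction x g E₁ G ∧ HasSymbolicRestriction x h E₂ H ∧ E = E₁ + E₂ := by
  classical
  obtain ⟨ξ, m, α₀, c, hξ, hm, hα₀, hα₀m, hEm, hc0, hξc, hprim, hedge, hcone⟩ :=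
    hE.exists_direction
  have hcreal : realVec c ≠ 0 := fun h => hc0 (by
    funext i
    have h1 : (c i : ℝ) = 0 := congrFun h i
    exact_mod_cast h1)
  obtain ⟨i₀, hi₀⟩ := exists_pos_of_dotProduct_eq_zero hξ hcreal hξc
  obtain ⟨j₀, hj₀⟩ := exists_pos_of_dotProduct_eq_zero hξ (neg_ne_zero.2 hcreal)
    (by rw [dotProduct_neg, hξc, neg_zero])
  have hi₀ : 0 < c i₀ := by
    rw [realVec] at hi₀
    exact_mod_cast hi₀
  have hj₀ : c j₀ < 0 := by
    rw [Pi.neg_apply, neg_pos, realVec] at hj₀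
    exact_mod_cast hj₀
  -- the exponents of `G * H` are those of `a` of weight `m`
  have hcoeff : ∀ α, ξ ⬝ᵥ toPoint α = m → (G * H).coeff α = residue S (a.coeff α) := by
    intro α hα
    rw [← hGH, coeff_symbolicRestriction]
    split_ifs with h
    · rfl
    · have h0 : a.coeff α = 0 := by
        by_contra hne
        exact h (hEm ▸ subset_convexHull _ _ ⟨α, ⟨hne, hα⟩, rfl⟩)
      rw [h0, map_zero]
  have hsupp : ((G * H).support : Set (Fin n →₀ ℕ)) =
      {α | a.coeff α ≠ 0 ∧ ξ ⬝ᵥ toPoint α = m} := by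
    ext α
    constructor
    · intro hα
      have h1 := mem_support_iff.1 hα
      rw [← hGH, coeff_symbolicRestriction] at h1
      have hαE : toPoint α ∈ E := by
        by_contra h
        rw [if_neg h] at h1
        exact h1 rfl
      rw [if_pos hαE] at h1
      refine ⟨fun h0 => h1 (by rw [h0, map_zero]), ?_⟩
      rw [hEm] at hαE
      refine dotProduct_eq_of_mem_convexHull ?_ hαE
      rintro _ ⟨β, hβ, rfl⟩
      exact hβ.2
    · rintro ⟨h1, h2⟩
      refine mem_support_iff.2 ?_
      rw [hcoeff α h2]
      exact (residue_ne_zero_iff_isUnit _).2 ((ha.1 α).resolve_left h1)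
  have hGH0 : G * H ≠ 0 := by
    refine support_nonempty.1 ⟨α₀, ?_⟩
    rw [← Finset.mem_coe, hsupp]
    exact ⟨hα₀, hα₀m⟩
  have hline : ∀ γ ∈ (G * H).support, γ ∈ lineSet c (intVec α₀) := by
    intro γ hγ
    rw [← Finset.mem_coe, hsupp] at hγ
    exact hedge γ hγ.1 hγ.2
  have hG0 : G ≠ 0 := left_ne_zero_of_mul hGH0
  have hH0 : H ≠ 0 := right_ne_zero_of_mul hGH0
  obtain ⟨p, hp, p', hp', d, hpd, hGd⟩ := exists_endpoints hi₀ hG0 fun β hβ =>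
    support_subset_lineSet_of_mul hprim hi₀ hj₀ hGH0 hline hβ
  obtain ⟨q, hq, q', hq', e, hqe, hHe⟩ := exists_endpoints hi₀ hH0 fun β hβ =>
    support_subset_lineSet_of_mul (Q := G) hprim hi₀ hj₀ (mul_comm G H ▸ hGH0)
      (mul_comm G H ▸ hline) hβ
  have hGp : ∀ α ∈ G.support, α ∈ lineSet c (intVec p) := fun α hα => by
    obtain ⟨k, -, hk⟩ := hGd α hα
    exact ⟨k, hk⟩
  have hHq : ∀ α ∈ H.support, α ∈ lineSet c (intVec q) := fun α hα => by
    obtain ⟨k, -, hk⟩ := hHe α hα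
    exact ⟨k, hk⟩
  have hGw : ∀ α ∈ G.support, ξ ⬝ᵥ toPoint α = ξ ⬝ᵥ toPoint p := fun α hα => by
    rw [dotProduct_eq_of_mem_lineSet hξc (hGp α hα), realVec_intVec]
  have hHw : ∀ α ∈ H.support, ξ ⬝ᵥ toPoint α = ξ ⬝ᵥ toPoint q := fun α hα => by
    rw [dotProduct_eq_of_mem_lineSet hξc (hHq α hα), realVec_intVec]
  obtain ⟨hpq, hsum⟩ := convexHull_support_mul hi₀ hp hp' hpd hGd hq hq' hqe hHe
  obtain ⟨k₀, hk₀⟩ := toPoint_eq_of_mem_lineSet (hline _ hpq)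
  rw [realVec_intVec] at hk₀
  have hpqm : ξ ⬝ᵥ toPoint p + ξ ⬝ᵥ toPoint q = m := by
    rw [← Finset.mem_coe, hsupp] at hpq
    rw [← dotProduct_add, ← toPoint_add]
    exact hpq.2
  -- `ε` is a lower bound for the `ξ i` and for the gaps between `m` and the larger weights of
  -- the exponents of `a`
  -- `ε` is a lower bound for the `ξ i` and for the gaps between `m` and the larger weights of
  -- the exponents of `a`
  obtain ⟨ε, hε0, hε⟩ := exists_pos_forall_le
    (Finset.univ.image ξ ∪ (a.support.image fun α => ξ ⬝ᵥ toPoint α - m).filter (0 < ·)) (by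
      intro r hr
      rcases Finset.mem_union.1 hr with h | h
      · obtain ⟨i, -, rfl⟩ := Finset.mem_image.1 h
        exact hξ i
      · exact (Finset.mem_filter.1 h).2)
  have hεξ : ∀ i, ε ≤ ξ i := fun i =>
    hε _ (Finset.mem_union_left _ (Finset.mem_image_of_mem _ (Finset.mem_univ i)))
  have hεa : ∀ α, a.coeff α ≠ 0 → ξ ⬝ᵥ toPoint α ≠ m → m + ε ≤ ξ ⬝ᵥ toPoint α := by
    intro α hα hne
    have h1 := hε (ξ ⬝ᵥ toPoint α - m) (Finset.mem_union_right _ (Finset.mem_filter.2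
      ⟨Finset.mem_image_of_mem _ (mem_support_iff.2 hα),
        sub_pos.2 (lt_of_le_of_ne (hm α hα) (Ne.symm hne))⟩))
    linarith
  obtain ⟨G', hG'map, hG'supp, hG'unit⟩ := exists_unit_lift G
  obtain ⟨H', hH'map, hH'supp, hH'unit⟩ := exists_unit_lift H
  have hmul : ∀ γ, (G' * H').coeff γ ≠ 0 → γ ∈ coneSet ξ c (p + q) m ∧ ξ ⬝ᵥ toPoint γ = m := by
    intro γ hγ
    obtain ⟨α, hα, β, hβ, rfl⟩ := Finset.mem_add.1 (support_mul _ _ (mem_support_iff.2 hγ))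
    rw [hG'supp] at hα
    rw [hH'supp] at hβ
    have h1 : ξ ⬝ᵥ toPoint (α + β) = m := by
      rw [toPoint_add, dotProduct_add, hGw α hα, hHw β hβ, hpqm]
    obtain ⟨k, hk⟩ := toPoint_eq_of_mem_lineSet (hGp α hα)
    obtain ⟨l, hl⟩ := toPoint_eq_of_mem_lineSet (hHq β hβ)
    refine ⟨⟨h1.ge, k + l, ?_⟩, h1⟩
    rw [toPoint_add, toPoint_add, hk, hl, realVec_intVec, realVec_intVec, add_smul,
      add_add_add_comm]
  have hf : f - eval x G' * eval x H' ∈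
      monomialIdeal x (coneSet ξ c (p + q) (ξ ⬝ᵥ toPoint p + ξ ⬝ᵥ toPoint q + ε)) := by
    -- the terms of `a - G' * H'` of weight `m` have coefficients in the maximal ideal
    -- the terms of `a - G' * H'` of weight `m` have coefficients in the maximal ideal
    rw [hpqm, ← ha.2, ← map_mul, ← map_sub, eval_eq_sum_monomialAt]
    refine Ideal.sum_mem _ fun γ hγ => ?_
    have hγa : (G' * H').coeff γ = 0 → a.coeff γ ≠ 0 := by
      intro h0 h1
      rw [mem_support_iff, coeff_sub, h0, h1, sub_zero] at hγ
      exact hγ rfl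
    have hγcone : γ ∈ coneSet ξ c (p + q) m := by
      by_cases h0 : (G' * H').coeff γ = 0
      · refine ⟨hm γ (hγa h0), ?_⟩
        obtain ⟨t, ht⟩ := hcone γ (hγa h0)
        refine ⟨t - k₀, ?_⟩
        rw [hk₀, add_assoc, ← add_smul, add_sub_cancel]
        exact ht
      · exact (hmul γ h0).1
    by_cases hγm : ξ ⬝ᵥ toPoint γ = m
    · refine mul_monomialAt_mem hspan hεξ hγcone ?_
      rw [← residue_eq_zero_iff, coeff_sub, map_sub, ← hcoeff γ hγm, ← coeff_map, map_mul,
        hG'map, hH'map, sub_self]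
    · have h0 : (G' * H').coeff γ = 0 := by
        by_contra h
        exact hγm (hmul γ h).2
      exact Ideal.mul_mem_left _ _ (monomialAt_mem ⟨hεa γ (hγa h0) hγm, hγcone.2⟩)
  obtain ⟨g, h, hgh, hg, hh⟩ := exists_factors hspan hprim hi₀ hj₀ hξ hξc hε0 hεξ
    (endpoint_eq_of_not_dvd hG hpd hGd) (by rwa [hG'map]) (by rwa [hG'map, hH'map])
    (hG'supp ▸ hGp) (hH'supp ▸ hHq) hf
  refine ⟨g, h, hgh, convexHull ℝ (toPoint '' (G.support : Set (Fin n →₀ ℕ))),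
    convexHull ℝ (toPoint '' (H.support : Set (Fin n →₀ ℕ))), ?_, ?_, ?_⟩
  · have h1 := hasSymbolicRestriction_of_sub_mem hspan hx hξ hε0 hG'unit
      (fun h0 => hG0 (by rw [← hG'map, h0, map_zero])) (hG'supp ▸ hGw) hg
    rwa [hG'map, hG'supp] at h1
  · have h1 := hasSymbolicRestriction_of_sub_mem hspan hx hξ hε0 hH'unit
      (fun h0 => hH0 (by rw [← hH'map, h0, map_zero])) (hH'supp ▸ hHw) hh
    rwa [hH'map, hH'supp] at h1
  · rw [← hsum, hsupp, ← hEm]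

end Factorization

/-! ### Transport of polynomials to the completion -/

section Transport

open IsLocalRing MvPolynomial

variable {R : Type*} [CommRing R] [IsLocalRing R] {n : ℕ}

lemma IsExpansion.completion {x : Fin n → R} {f : R} {a : MvPolynomial (Fin n) R}
    (ha : IsExpansion x f a) :
    IsExpansion (fun i => algebraMap R (Completion R) (x i)) (algebraMap R (Completion R) f)
      (map (algebraMap R (Completion R)) a) := by
  refine ⟨fun α => ?_, ?_⟩
  · rw [coeff_map]
    rcases ha.1 α with h | h
    · left; rw [h, map_zero]
    · right; exact h.map _
  · rw [← ha.2]
    exact (map_eval (algebraMap R (Completion R)) x a).symm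

variable [IsNoetherianRing R]

/-- The polynomial rings over the residue fields of `R` and of its completion are isomorphic. -/
noncomputable def toCompletionEquiv (R : Type*) [CommRing R] [IsLocalRing R] [IsNoetherianRing R]
    (n : ℕ) : MvPolynomial (Fin n) (ResidueField R) ≃+*
      MvPolynomial (Fin n) (ResidueField (Completion R)) :=
  mapEquiv (Fin n) (RingEquiv.ofBijective _ (AdicCompletion.residueField_map_bijective R))

lemma toCompletionEquiv_apply (G : MvPolynomial (Fin n) (ResidueField R)) :
    toCompletionEquiv R n G = toCompletion G := rfl

lemma isRelPrime_toCompletion {G H : MvPolynomial (Fin n) (ResidueField R)}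
    (h : IsRelPrime G H) : IsRelPrime (toCompletion G) (toCompletion H) := by
  intro D hG hH
  rw [← toCompletionEquiv_apply] at hG hH
  have h1 := map_dvd (toCompletionEquiv R n).symm hG
  have h2 := map_dvd (toCompletionEquiv R n).symm hH
  rw [RingEquiv.symm_apply_apply] at h1 h2
  exact (MulEquiv.isUnit_map (toCompletionEquiv R n).symm).1 (h h1 h2)

lemma not_X_dvd_toCompletion {G : MvPolynomial (Fin n) (ResidueField R)} {i : Fin n}
    (h : ¬ X i ∣ G) : ¬ X i ∣ toCompletion G := by
  intro hd
  apply h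
  have h1 := map_dvd (toCompletionEquiv R n).symm hd
  have h2 : (toCompletionEquiv R n) (X i) = X i := by
    rw [toCompletionEquiv_apply, toCompletion, map_X]
  rwa [← toCompletionEquiv_apply, ← h2, RingEquiv.symm_apply_apply,
    RingEquiv.symm_apply_apply] at h1

lemma coeff_map_completion_eq_zero_iff {a : MvPolynomial (Fin n) R}
    (hunit : ∀ α, a.coeff α = 0 ∨ IsUnit (a.coeff α)) (α : Fin n →₀ ℕ) :
    (map (algebraMap R (Completion R)) a).coeff α = 0 ↔ a.coeff α = 0 := by
  rw [coeff_map]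
  refine ⟨fun h => (hunit α).resolve_right fun hu => ?_, fun h => by rw [h, map_zero]⟩
  exact (hu.map (algebraMap R (Completion R))).ne_zero h

lemma newtonPolyhedron_map_completion {a : MvPolynomial (Fin n) R}
    (hunit : ∀ α, a.coeff α = 0 ∨ IsUnit (a.coeff α)) :
    newtonPolyhedron (map (algebraMap R (Completion R)) a) = newtonPolyhedron a := by
  simp only [newtonPolyhedron, ne_eq, coeff_map_completion_eq_zero_iff hunit]

lemma symbolicRestriction_map_completion (a : MvPolynomial (Fin n) R) (E : Set (Fin n → ℝ)) :
    symbolicRestriction (map (algebraMap R (Completion R)) a) E =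
      toCompletion (symbolicRestriction a E) := by
  classical
  ext α
  rw [toCompletion, coeff_map, coeff_symbolicRestriction, coeff_symbolicRestriction, coeff_map]
  split_ifs
  · rw [ResidueField.map_residue]
  · rw [map_zero]

end Transport

end NewtonEdge

theorem theorem1p1 {R : Type*} [CommRing R] [IsRegularLocalRing R] {n : ℕ}
    (x : Fin n → R) (hx : NewtonEdge.IsRegularSystemOfParameters x)
    (f : R) (hf : f ≠ 0)
    (a : MvPolynomial (Fin n) R) (ha : NewtonEdge.IsExpansion x f a)
    (E : Set (Fin n → ℝ)) (hE : NewtonEdge.IsLooseEdge (NewtonEdge.newtonPolyhedron a) E)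
    (G H : MvPolynomial (Fin n) (IsLocalRing.ResidueField R))
    (hGH : NewtonEdge.symbolicRestriction a E = G * H)
    (hcoprime : IsRelPrime G H)
    (hG : ∀ i : Fin n, ¬ (MvPolynomial.X i ∣ G)) :
    ∃ g h : NewtonEdge.Completion R,
      algebraMap R (NewtonEdge.Completion R) f = g * h ∧
      ∃ E₁ E₂ : Set (Fin n → ℝ),
        NewtonEdge.HasSymbolicRestriction
          (fun i => algebraMap R (NewtonEdge.Completion R) (x i)) g E₁
          (NewtonEdge.toCompletion G) ∧
        NewtonEdge.HasSymbolicRestriction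
          (fun i => algebraMap R (NewtonEdge.Completion R) (x i)) h E₂
          (NewtonEdge.toCompletion H) ∧
        E = E₁ + E₂ := by
  have ha' := ha.completion
  refine NewtonEdge.exists_factorization_of_isLooseEdge
    (NewtonEdge.span_range_algebraMap_completion hx.1) (hx.monomiallyIndependent.completion hx.1)
    ha' (by rwa [NewtonEdge.newtonPolyhedron_map_completion ha.1]) ?_
    (NewtonEdge.isRelPrime_toCompletion hcoprime)
    fun i => NewtonEdge.not_X_dvd_toCompletion (hG i)
  rw [NewtonEdge.symbolicRestriction_map_completion, hGH, NewtonEdge.toCompletion,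
    NewtonEdge.toCompletion, NewtonEdge.toCompletion, map_mul]
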